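/- For real $\nu>0$ let $J_\nu$ and $Y_\nu$ denote the Bessel functions of the first and second kind of order $\nu$ on $(0,\infty)$. For real $l>-\tfrac12$ define the Riccati–Bessel functions $$u_l(x)=\sqrt{\frac{\pi x}{2}}\,J_{l+\frac12}(x),\qquad v_l(x)=\sqrt{\frac{\pi x}{2}}\,Y_{l+\frac12}(x),\qquad x>0.$$ **Theorem.** Let $l$ and $L$ be real numbers with $l>-\tfrac12$, $L>-\tfrac12$ and $L\neq l$, and let $$W_{Ll}(x)=u_L(x)\,v_l'(x)-u_L'(x)\,v_l(x),\qquad x>0,$$ where the prime denotes differentiation in $x$. Then $$W_{Ll}(x)\neq 0\ \text{ for all } x\in(0,\infty)\quad\Longleftrightarrow\quad 0<|L-l|\le 1 .$$ -/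

import Mathlib

/-- The Bessel function of the first kind of real order `ν`, for `x > 0`:
`J_ν(x) = ∑ₖ (-1)ᵏ / (k! Γ(k + ν + 1)) (x / 2)^(2k + ν)`.
At the poles of `Γ` Mathlib's `Real.Gamma` is `0`, so that `1 / Γ` has there its usual value `0`. -/
noncomputable def besselJ (ν x : ℝ) : ℝ :=
  ∑' k : ℕ, (-1 : ℝ) ^ k / ((k.factorial : ℝ) * Real.Gamma ((k : ℝ) + ν + 1)) *
    (x / 2) ^ (2 * (k : ℝ) + ν)

theorem besselJ_inv_gamma_bound (R : ℝ) : ∃ C : ℝ, ∀ k : ℕ, ∀ z : ℂ, ‖z‖ ≤ R →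
    ‖(Complex.Gamma (k + z + 1))⁻¹‖ ≤ C := by
  obtain ⟨N, hN⟩ := exists_nat_gt (R + 1)
  have hc : ∀ k : ℕ, ∃ C : ℝ, ∀ z : ℂ, ‖z‖ ≤ R → ‖(Complex.Gamma (k + z + 1))⁻¹‖ ≤ C := by
    intro k
    have hcont : Continuous fun z : ℂ => (Complex.Gamma (k + z + 1))⁻¹ :=
      Complex.differentiable_one_div_Gamma.continuous.comp (by fun_prop)
    obtain ⟨C, hC⟩ := (isCompact_closedBall (0 : ℂ) R).exists_bound_of_continuousOn
      hcont.continuousOn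
    exact ⟨C, fun z hz => hC z (by simpa using hz)⟩
  choose C hC using hc
  refine ⟨∑ k ∈ Finset.range (N + 1), |C k|, ?_⟩
  have h1 : ∀ k ≤ N, ∀ z : ℂ, ‖z‖ ≤ R → ‖(Complex.Gamma (k + z + 1))⁻¹‖ ≤
      ∑ k ∈ Finset.range (N + 1), |C k| := fun k hk z hz =>
    ((hC k z hz).trans (le_abs_self _)).trans
      (Finset.single_le_sum (f := fun k => |C k|) (fun _ _ => abs_nonneg _)
        (Finset.mem_range.2 (Nat.lt_succ_of_le hk)))
  intro k z hz
  rcases le_total k N with hk | hk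
  · exact h1 k hk z hz
  · induction k, hk using Nat.le_induction with
    | base => exact h1 N le_rfl z hz
    | succ k hk ih =>
      have hre : 1 ≤ ((k : ℂ) + z + 1).re := by
        have : (N : ℝ) ≤ k := by exact_mod_cast hk
        have h3 := (abs_le.1 ((Complex.abs_re_le_norm z).trans hz)).1
        simp
        linarith
      have hn : 1 ≤ ‖(k : ℂ) + z + 1‖ :=
        hre.trans ((le_abs_self _).trans (Complex.abs_re_le_norm _))
      have hne : (k : ℂ) + z + 1 ≠ 0 := by
        intro h; rw [h] at hn; simp at hn; linarith
      have : ((k + 1 : ℕ) : ℂ) + z + 1 = ((k : ℂ) + z + 1) + 1 := by push_cast; ring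
      rw [this, Complex.Gamma_add_one _ hne, mul_inv, norm_mul, norm_inv]
      have h4 : ‖(k : ℂ) + z + 1‖⁻¹ ≤ 1 := inv_le_one_of_one_le₀ hn
      calc _ ≤ 1 * ‖(Complex.Gamma (k + z + 1))⁻¹‖ := by gcongr
        _ ≤ _ := by simpa using ih

theorem besselJ_differentiable (x : ℝ) (hx : 0 < x) : Differentiable ℝ fun ν => besselJ ν x := by
  let F : ℂ → ℂ := fun z => ∑' k : ℕ, (-1 : ℂ) ^ k / (k.factorial : ℂ) *
    (Complex.Gamma (k + z + 1))⁻¹ * ((x / 2 : ℝ) : ℂ) ^ (2 * k)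
  have hF : Differentiable ℂ F := by
    intro z
    obtain ⟨C, hC⟩ := besselJ_inv_gamma_bound (‖z‖ + 1)
    have hd := Complex.differentiableOn_tsum_of_summable_norm
      (U := Metric.ball (0 : ℂ) (‖z‖ + 1)) (F := fun (k : ℕ) z => (-1 : ℂ) ^ k / (k.factorial : ℂ) *
        (Complex.Gamma (k + z + 1))⁻¹ * ((x / 2 : ℝ) : ℂ) ^ (2 * k))
      (u := fun k => C * (((x / 2) ^ 2) ^ k / (k.factorial : ℝ)))
      ((Real.summable_pow_div_factorial _).mul_left C) ?_ Metric.isOpen_ball ?_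
    · exact hd.differentiableAt (Metric.isOpen_ball.mem_nhds (by simp))
    · intro k
      have : Differentiable ℂ fun z : ℂ => (Complex.Gamma (k + z + 1))⁻¹ :=
        Complex.differentiable_one_div_Gamma.comp (by fun_prop)
      exact ((this.const_mul _).mul_const _).differentiableOn
    · intro k w hw
      have hw' : ‖w‖ ≤ ‖z‖ + 1 := by simpa using (Metric.mem_ball.1 hw).le
      have := hC k w hw'
      have e : ‖((x / 2 : ℝ) : ℂ) ^ (2 * k)‖ = ((x / 2) ^ 2) ^ k := by
        rw [norm_pow, Complex.norm_real, Real.norm_of_nonneg (by positivity), pow_mul]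
      rw [norm_mul, norm_mul, e, norm_div, norm_pow, norm_neg, norm_one, one_pow,
        Complex.norm_natCast]
      calc _ ≤ 1 / (k.factorial : ℝ) * C * ((x / 2) ^ 2) ^ k := by gcongr
        _ = _ := by ring
  have hJ : (fun ν => besselJ ν x) = fun ν : ℝ => (F ν).re * (x / 2) ^ ν := by
    funext ν
    have : F ν = ((∑' k : ℕ, (-1 : ℝ) ^ k / (k.factorial : ℝ) *
        (Real.Gamma (k + ν + 1))⁻¹ * (x / 2) ^ (2 * k) : ℝ) : ℂ) := by
      rw [Complex.ofReal_tsum]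
      refine tsum_congr fun k => ?_
      push_cast [Complex.Gamma_ofReal]
      rw [← Complex.Gamma_ofReal]
      push_cast
      rfl
    rw [this, Complex.ofReal_re, besselJ, ← tsum_mul_right]
    refine tsum_congr fun k => ?_
    rw [Real.rpow_add (by positivity), show (2 * (k : ℝ)) = ((2 * k : ℕ) : ℝ) by push_cast; ring,
      Real.rpow_natCast]
    rw [div_mul_eq_div_div, div_eq_mul_inv _ (Real.Gamma _)]
    ring
  rw [hJ]
  intro ν
  have h1 : DifferentiableAt ℝ (fun ν : ℝ => (F ν).re) ν :=
    ((hF ν).hasDerivAt.real_of_complex).differentiableAt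
  have h2 : DifferentiableAt ℝ (fun ν : ℝ => (x / 2) ^ ν) ν :=
    (Real.hasStrictDerivAt_const_rpow (by positivity) ν).hasDerivAt.differentiableAt
  exact h1.mul h2

theorem besselJ_neg_nat (x : ℝ) (n : ℕ) :
    besselJ (-(n : ℝ)) x = (-1) ^ n * besselJ n x := by
  unfold besselJ
  rw [← tsum_mul_left]
  rw [← Function.Injective.tsum_eq (g := fun k : ℕ => k + n) (add_left_injective n)]
  · refine tsum_congr fun k => ?_
    have e1 : ((k + n : ℕ) : ℝ) + -(n : ℝ) + 1 = k + 1 := by push_cast; ring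
    have e2 : 2 * ((k + n : ℕ) : ℝ) + -(n : ℝ) = 2 * k + n := by push_cast; ring
    have e3 : (k : ℝ) + n + 1 = ((k + n : ℕ) : ℝ) + 1 := by push_cast; ring
    rw [e1, e2, e3, Real.Gamma_nat_eq_factorial, Real.Gamma_nat_eq_factorial, pow_add]
    ring
  · intro k hk
    by_contra hkn
    have hlt : k < n := by
      by_contra h
      exact hkn ⟨k - n, by simp; omega⟩
    apply hk
    have : (k : ℝ) + -(n : ℝ) + 1 = -((n - k - 1 : ℕ) : ℝ) := by
      rw [Nat.cast_sub (by omega), Nat.cast_sub (by omega)]; push_cast; ring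
    simp [this, Real.Gamma_neg_nat_eq_zero]

theorem besselY_limit_exists (n : ℤ) (x : ℝ) (hx : 0 < x) : ∃ y : ℝ, Filter.Tendsto (fun μ : ℝ =>
      (besselJ μ x * Real.cos (μ * Real.pi) - besselJ (-μ) x) / Real.sin (μ * Real.pi))
      (nhdsWithin (n : ℝ) {(n : ℝ)}ᶜ) (nhds y) := by
  have hJ := besselJ_differentiable x hx
  have hN : Differentiable ℝ fun μ : ℝ =>
      besselJ μ x * Real.cos (μ * Real.pi) - besselJ (-μ) x :=
    (hJ.mul (by fun_prop)).sub (hJ.comp differentiable_neg)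
  have hS : HasDerivAt (fun μ : ℝ => Real.sin (μ * Real.pi))
      (Real.cos (n * Real.pi) * (1 * Real.pi)) n :=
    ((hasDerivAt_id (n : ℝ)).mul_const Real.pi).sin
  have hS0 : Real.sin (n * Real.pi) = 0 := Real.sin_int_mul_pi n
  have hc : Real.cos (n * Real.pi) ≠ 0 := by
    intro h
    have := Real.sin_sq_add_cos_sq (n * Real.pi)
    rw [hS0, h] at this
    norm_num at this
  have hN0 : besselJ n x * Real.cos (n * Real.pi) - besselJ (-n) x = 0 := by
    obtain ⟨m, rfl | rfl⟩ := n.eq_nat_or_neg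
    · have := Real.cos_nat_mul_pi m
      push_cast
      rw [this, besselJ_neg_nat]; ring
    · have := Real.cos_nat_mul_pi m
      push_cast
      rw [neg_mul, Real.cos_neg, this, neg_neg, besselJ_neg_nat, mul_right_comm, ← mul_pow]
      simp
  have h1 := (hN (n : ℝ)).hasDerivAt.tendsto_slope
  have h2 := hS.tendsto_slope
  refine ⟨_, (h1.div h2 (by simp [hc, Real.pi_ne_zero])).congr' ?_⟩
  filter_upwards [self_mem_nhdsWithin] with μ hμ
  have hμ' : μ - n ≠ 0 := sub_ne_zero.2 hμ
  simp only [Pi.div_apply, slope_def_field, hN0, hS0, sub_zero]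
  exact div_div_div_cancel_right₀ hμ' _ _

open Classical in
/-- The Bessel function of the second kind of real order `ν`, for `x > 0`:
`Y_ν(x) = (J_ν(x) cos(νπ) - J_{-ν}(x)) / sin(νπ)` if `ν` is not an integer, and the limit of this
quotient as the order tends to `ν` if `ν` is an integer. -/
noncomputable def besselY (ν x : ℝ) : ℝ :=
  if ∃ n : ℤ, ν = n then
    Filter.limUnder (nhdsWithin ν {ν}ᶜ) (fun μ : ℝ =>
      (besselJ μ x * Real.cos (μ * Real.pi) - besselJ (-μ) x) / Real.sin (μ * Real.pi))
  else (besselJ ν x * Real.cos (ν * Real.pi) - besselJ (-ν) x) / Real.sin (ν * Real.pi)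

/-- At an integer order the limit that defines `besselY` exists. -/
theorem tendsto_besselY_int (n : ℤ) (x : ℝ) (hx : 0 < x) : Filter.Tendsto (fun μ : ℝ =>
      (besselJ μ x * Real.cos (μ * Real.pi) - besselJ (-μ) x) / Real.sin (μ * Real.pi))
      (nhdsWithin (n : ℝ) {(n : ℝ)}ᶜ) (nhds (besselY n x)) := by
  rw [besselY, if_pos ⟨n, rfl⟩]
  exact tendsto_nhds_limUnder (besselY_limit_exists n x hx)

/-- The regular Riccati–Bessel function `u_l(x) = √(πx/2) J_{l+1/2}(x)`. -/
noncomputable def riccatiU (l x : ℝ) : ℝ :=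
  Real.sqrt (Real.pi * x / 2) * besselJ (l + 1 / 2) x

/-- The irregular Riccati–Bessel function `v_l(x) = √(πx/2) Y_{l+1/2}(x)`. -/
noncomputable def riccatiV (l x : ℝ) : ℝ :=
  Real.sqrt (Real.pi * x / 2) * besselY (l + 1 / 2) x

/-- The Wronskian `W_{Ll}(x) = u_L(x) v_l'(x) - u_L'(x) v_l(x)`. -/
noncomputable def riccatiWronskian (L l x : ℝ) : ℝ :=
  riccatiU L x * deriv (riccatiV l) x - deriv (riccatiU L) x * riccatiV l x

/-!
The Wronskian `W = W_{Ll}` is a multiple of `w = x (J_ν Y_μ' - J_ν' Y_μ)`, where `ν = L + 1/2` and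
`μ = l + 1/2`, and `w' = (μ² - ν²) J_ν Y_μ / x`. Thus the critical points of `w` are the zeros of
`J_ν` and of `Y_μ`. In polar coordinates `J_ν = M_ν cos θ_ν`, `Y_ν = M_ν sin θ_ν`, with the phase
normalized by `θ_ν(0) = -π/2`, the sign of `w` at such a point is the sign of `cos (θ_μ - θ_ν)`
(`wronskianJY_of_besselJ_eq_zero`, `wronskianJY_of_besselY_eq_zero`), and `w > 0` near `0`.

Let `μ < ν`. Since `θ_ν' = 2 / (π x M_ν²)` and `M_ν` increases with the order, the difference
`θ_μ - θ_ν` is positive and increasing in `x`. For `ν = μ + 1` it stays below `π / 2`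
(`phase_sub_phase_add_one_lt`) and tends to `π / 2`
(`tendsto_phase_sub_phase_add_one`), because `M_μ M_{μ+1} cos (θ_μ - θ_{μ+1})` is
`J_μ J_{μ+1} + Y_μ Y_{μ+1}`, which is positive and `o(1 / x)`, while `x M_μ M_{μ+1} → 2 / π`. So
for `ν ≤ μ + 1` all critical values of `w` are positive, and `w` has no zero. For `ν > μ + 1` the
difference of the phases eventually exceeds `π / 2`, and it cannot jump over `(π / 2, 3 π / 2)` between two consecutive zeros of `Y_μ`;
so `w` takes a value `≤ 0` at one of them, and it has a zero. The case `ν < μ` is the same, with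
the zeros of `J_ν`.

The monotonicity of `M_ν` in the order and the sign of `J_μ J_{μ+1} + Y_μ Y_{μ+1}` are read off
from Nicholson's formula `M_ν² = (8 / π²) ∫₀^∞ K_0(2 x sinh t) cosh (2 ν t) dt`
(`besselJ_sq_add_besselY_sq`, `besselJ_mul_add_besselY_mul`). To prove it, let `F_ν` be this
integral and `H_ν = (ν F_ν - x F_ν' / 2) / x`. The functions `F_ν`, `F_{ν+1}`, `H_ν` satisfy the
linear differential system of the products of neighbouring Bessel functions, hence both
`x² (F_ν F_{ν+1} - H_ν²)` and the form `x² (F_ν J_{ν+1}² + F_{ν+1} J_ν² - 2 H_ν J_ν J_{ν+1})` are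
constant in `x`. The first constant is found as `x → ∞` (`modSq_mul_modSq_sub`), the second as
`x → 0` if `ν > 0` and then for all real `ν` by analyticity in the order (`nicholsonForm_besselJ`).
Reflection of the order gives the value of the form on `J_{-ν}`, and the determinant then gives its
value on the pair `J_ν`, `J_{-ν}` up to a sign, which is again settled by analyticity in the order
(`nicholsonForm_besselJ_besselJ_neg`). These values express `Y_ν` by `J_ν`, `J_{ν+1}`, `F_ν` and
`H_ν` (`besselY_eq`); all properties of `Y_ν` that are used, also at the integer orders, follow
from this expression.
-/

open Real Set Filter Topology MeasureTheory

namespace Bessel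

/-! ### The entire factor of the Bessel function of the first kind -/

/-- The entire function `E_ν(w) = ∑ₖ (-w)ᵏ / (k! Γ(k + ν + 1))`, for which
`J_ν(x) = (x / 2) ^ ν E_ν(x² / 4)`. -/
noncomputable def entireJ (ν w : ℝ) : ℝ :=
  ∑' k : ℕ, (-1 : ℝ) ^ k / ((k.factorial : ℝ) * Real.Gamma ((k : ℝ) + ν + 1)) * w ^ k

theorem abs_inv_gamma_le (ν : ℝ) : ∃ C : ℝ, 0 ≤ C ∧ ∀ k : ℕ,
    |(Real.Gamma ((k : ℝ) + ν + 1))⁻¹| ≤ C := by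
  obtain ⟨C, hC⟩ := besselJ_inv_gamma_bound |ν|
  have h : ∀ k : ℕ, |(Real.Gamma ((k : ℝ) + ν + 1))⁻¹| ≤ C := by
    intro k
    have := hC k ν (by simp)
    rw [show (k : ℂ) + ν + 1 = ((k + ν + 1 : ℝ) : ℂ) by push_cast; rfl, Complex.Gamma_ofReal,
      ← Complex.ofReal_inv, Complex.norm_real] at this
    simpa using this
  exact ⟨C, (abs_nonneg _).trans (h 0), h⟩

theorem summable_entireJ (ν w : ℝ) : Summable fun k : ℕ =>
    (-1 : ℝ) ^ k / ((k.factorial : ℝ) * Real.Gamma ((k : ℝ) + ν + 1)) * w ^ k := by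
  obtain ⟨C, hC0, hC⟩ := abs_inv_gamma_le ν
  refine Summable.of_norm_bounded ((Real.summable_pow_div_factorial |w|).mul_left C) fun k => ?_
  rw [norm_mul, div_mul_eq_div_div, div_eq_mul_inv _ (Real.Gamma _), norm_mul, norm_div, norm_pow,
    norm_pow, norm_neg, norm_one, one_pow, Real.norm_eq_abs w, Real.norm_natCast,
    Real.norm_eq_abs (_⁻¹)]
  calc _ ≤ 1 / (k.factorial : ℝ) * C * |w| ^ k := by gcongr; exact hC k
    _ = _ := by ring

theorem hasDerivAt_entireJ (ν w : ℝ) : HasDerivAt (entireJ ν) (-entireJ (ν + 1) w) w := by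
  obtain ⟨C, hC0, hC⟩ := abs_inv_gamma_le ν
  set R := |w| + 1 with hR
  set a : ℕ → ℝ := fun k => (-1 : ℝ) ^ k / ((k.factorial : ℝ) * Real.Gamma ((k : ℝ) + ν + 1))
  have hu : Summable fun k : ℕ => C * ((k : ℝ) * R ^ (k - 1) / (k.factorial : ℝ)) := by
    refine Summable.mul_left C ((summable_nat_add_iff 1).1 ?_)
    refine (Real.summable_pow_div_factorial R).congr fun k => ?_
    rw [Nat.factorial_succ]
    push_cast
    field_simp
  have hd := hasDerivAt_tsum_of_isPreconnected (𝕜 := ℝ) (F := ℝ) (t := Metric.ball 0 R)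
    (g := fun k y => a k * y ^ k) (g' := fun k y => a k * ((k : ℝ) * y ^ (k - 1))) (y₀ := w)
    (y := w) hu Metric.isOpen_ball (convex_ball _ _).isPreconnected
    (fun k y _ => (hasDerivAt_pow k y).const_mul _) ?_ (by simp [hR]) (summable_entireJ ν w)
    (by simp [hR])
  · have e : ∑' k : ℕ, a k * ((k : ℝ) * w ^ (k - 1)) = -entireJ (ν + 1) w := by
      have hs : Summable fun k : ℕ => a k * ((k : ℝ) * w ^ (k - 1)) := by
        refine (summable_nat_add_iff 1).1 ((summable_entireJ (ν + 1) w).neg.congr fun k => ?_)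
        simp only [a, Nat.factorial_succ, Nat.add_sub_cancel]
        rw [show ((k + 1 : ℕ) : ℝ) + ν + 1 = k + (ν + 1) + 1 by push_cast; ring]
        push_cast
        field_simp
        ring
      rw [hs.tsum_eq_zero_add]
      simp only [Nat.cast_zero, zero_mul, mul_zero, zero_add]
      rw [entireJ, ← tsum_neg]
      refine tsum_congr fun k => ?_
      simp only [a, Nat.factorial_succ, Nat.add_sub_cancel]
      rw [show ((k + 1 : ℕ) : ℝ) + ν + 1 = k + (ν + 1) + 1 by push_cast; ring]
      push_cast
      field_simp
      ring
    rw [← e]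
    exact hd
  · intro k y hy
    have hy' : |y| ≤ R := by simpa using (Metric.mem_ball.1 hy).le
    simp only [a]
    rw [norm_mul, div_mul_eq_div_div, div_eq_mul_inv _ (Real.Gamma _), norm_mul, norm_div, norm_pow,
      norm_mul, norm_pow, norm_neg, norm_one, one_pow, Real.norm_eq_abs y, Real.norm_natCast,
      Real.norm_natCast, Real.norm_eq_abs (_⁻¹)]
    calc _ ≤ 1 / (k.factorial : ℝ) * C * (k * R ^ (k - 1)) := by gcongr; exact hC k
      _ = _ := by ring

theorem continuous_entireJ (ν : ℝ) : Continuous (entireJ ν) :=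
  continuous_iff_continuousAt.2 fun w => (hasDerivAt_entireJ ν w).continuousAt

theorem entireJ_zero (ν : ℝ) : entireJ ν 0 = (Real.Gamma (ν + 1))⁻¹ := by
  rw [entireJ, tsum_eq_single 0 (fun k hk => by simp [hk])]
  simp

/-- The reciprocal Gamma function satisfies `s / Γ(s + 1) = 1 / Γ(s)` also at the poles, where
Mathlib's `Γ` is `0`. -/
theorem mul_inv_gamma_add_one (s : ℝ) : s * (Real.Gamma (s + 1))⁻¹ = (Real.Gamma s)⁻¹ := by
  rcases eq_or_ne s 0 with rfl | hs
  · simp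
  · rw [Real.Gamma_add_one hs, mul_inv, ← mul_assoc, mul_inv_cancel₀ hs, one_mul]

/-- The three-term recurrence of the Bessel functions, for their entire factors. -/
theorem entireJ_recurrence (ν w : ℝ) :
    entireJ ν w = (ν + 1) * entireJ (ν + 1) w - w * entireJ (ν + 2) w := by
  have h1 := (summable_entireJ (ν + 1) w).hasSum.mul_left (ν + 1)
  have h2 : HasSum (fun k : ℕ => (-1 : ℝ) ^ k / ((k.factorial : ℝ) *
      Real.Gamma ((k : ℝ) + (ν + 1) + 1)) * w ^ k * k) (-w * entireJ (ν + 2) w) := by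
    rw [← hasSum_nat_add_iff' 1]
    simp only [Finset.range_one, Finset.sum_singleton, Nat.cast_zero, mul_zero, sub_zero]
    have h3 := (summable_entireJ (ν + 2) w).hasSum.mul_left (-w)
    refine (funext fun k => ?_ : _ = fun i => _) ▸ h3
    rw [show ((k + 1 : ℕ) : ℝ) + (ν + 1) + 1 = k + (ν + 2) + 1 by push_cast; ring,
      Nat.factorial_succ]
    push_cast
    field_simp
    ring
  have h4 := (h1.add h2).tsum_eq
  rw [sub_eq_add_neg, ← neg_mul, entireJ, entireJ, ← h4]
  refine tsum_congr fun k => ?_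
  have := mul_inv_gamma_add_one ((k : ℝ) + ν + 1)
  rw [show (k : ℝ) + (ν + 1) + 1 = k + ν + 1 + 1 by ring, div_mul_eq_div_div, div_mul_eq_div_div,
    div_eq_mul_inv _ (Real.Gamma _), div_eq_mul_inv _ (Real.Gamma _), ← this]
  ring

/-! ### The Bessel function of the first kind -/

theorem besselJ_eq (ν : ℝ) {x : ℝ} (hx : 0 < x) :
    besselJ ν x = (x / 2) ^ ν * entireJ ν (x ^ 2 / 4) := by
  rw [besselJ, entireJ, ← tsum_mul_left]
  refine tsum_congr fun k => ?_
  rw [Real.rpow_add (by positivity), show (2 * (k : ℝ)) = ((2 * k : ℕ) : ℝ) by push_cast; ring,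
    Real.rpow_natCast, pow_mul]
  ring

theorem besselJ_recurrence (ν : ℝ) {x : ℝ} (hx : 0 < x) :
    besselJ ν x = 2 * (ν + 1) / x * besselJ (ν + 1) x - besselJ (ν + 2) x := by
  rw [besselJ_eq _ hx, besselJ_eq _ hx, besselJ_eq _ hx, entireJ_recurrence,
    Real.rpow_add (by positivity), Real.rpow_add (by positivity), Real.rpow_one, Real.rpow_two]
  field_simp
  ring

theorem hasDerivAt_besselJ (ν : ℝ) {x : ℝ} (hx : 0 < x) :
    HasDerivAt (besselJ ν) (ν / x * besselJ ν x - besselJ (ν + 1) x) x := by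
  have h1 : HasDerivAt (fun x : ℝ => (x / 2) ^ ν) (1 / 2 * ν * (x / 2) ^ (ν - 1)) x :=
    ((hasDerivAt_id x).div_const 2).rpow_const (Or.inl (by simp; positivity))
  have h2 : HasDerivAt (fun x : ℝ => entireJ ν (x ^ 2 / 4))
      (-entireJ (ν + 1) (x ^ 2 / 4) * (2 * x / 4)) x := by
    have h3 : HasDerivAt (fun x : ℝ => x ^ 2 / 4) (2 * x / 4) x := by
      simpa using (hasDerivAt_pow 2 x).div_const 4
    exact (hasDerivAt_entireJ ν (x ^ 2 / 4)).comp x h3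
  refine ((h1.mul h2).congr_of_eventuallyEq ?_).congr_deriv ?_
  · filter_upwards [lt_mem_nhds hx] with y hy using besselJ_eq ν hy
  · rw [besselJ_eq _ hx, besselJ_eq _ hx, Real.rpow_sub (by positivity),
      Real.rpow_add (by positivity), Real.rpow_one]
    field_simp
    ring

/-- The derivative of `J_{ν+1}` in terms of `J_ν`. -/
theorem hasDerivAt_besselJ_add_one (ν : ℝ) {x : ℝ} (hx : 0 < x) :
    HasDerivAt (besselJ (ν + 1)) (besselJ ν x - (ν + 1) / x * besselJ (ν + 1) x) x := by
  refine (hasDerivAt_besselJ (ν + 1) hx).congr_deriv ?_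
  rw [besselJ_recurrence ν hx, add_assoc, one_add_one_eq_two]
  ring

theorem tendsto_entireJ_zero (ν : ℝ) :
    Tendsto (fun x : ℝ => entireJ ν (x ^ 2 / 4)) (𝓝[>] 0) (𝓝 (Real.Gamma (ν + 1))⁻¹) := by
  have : Continuous fun x : ℝ => entireJ ν (x ^ 2 / 4) :=
    (continuous_entireJ ν).comp (by fun_prop)
  have h := this.tendsto 0
  norm_num [entireJ_zero] at h
  exact h.mono_left nhdsWithin_le_nhds

/-- A function with zero derivative on `(0, ∞)` equals its limit at either end of `(0, ∞)`. -/
theorem eq_of_hasDerivAt_zero {E : Type*} [NormedAddCommGroup E] [NormedSpace ℝ E] {f : ℝ → E}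
    {c : E} {l : Filter ℝ} [l.NeBot]
    (hf : ∀ x, 0 < x → HasDerivAt f 0 x) (hl : ∀ᶠ x in l, 0 < x) (hc : Tendsto f l (𝓝 c))
    {x : ℝ} (hx : 0 < x) : f x = c := by
  have hconst : ∀ y, 0 < y → f y = f x := fun y hy =>
    (convex_Ioi (0 : ℝ)).is_const_of_fderivWithin_eq_zero (𝕜 := ℝ)
      (fun z hz => (hf z hz).differentiableAt.differentiableWithinAt)
      (fun z hz => by
        have := (hf z hz).hasFDerivAt.hasFDerivWithinAt (s := Ioi 0)
        rw [this.fderivWithin (isOpen_Ioi.uniqueDiffWithinAt hz)]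
        ext; simp) hy hx
  refine tendsto_nhds_unique (tendsto_const_nhds.congr' ?_) hc
  filter_upwards [hl] with y hy using (hconst y hy).symm

/-- The Wronskian relation between `J_ν` and `J_{-ν}`, in terms of neighbouring orders. -/
theorem besselJ_cross (ν : ℝ) {x : ℝ} (hx : 0 < x) :
    x * (besselJ (ν + 1) x * besselJ (-ν) x + besselJ ν x * besselJ (-ν - 1) x) =
      -(2 * Real.sin (ν * π) / π) := by
  refine eq_of_hasDerivAt_zero (l := 𝓝[>] (0 : ℝ)) (f := fun x => x * (besselJ (ν + 1) x *
    besselJ (-ν) x + besselJ ν x * besselJ (-ν - 1) x)) (fun y hy => ?_) self_mem_nhdsWithin ?_ hx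
  · have h1 := hasDerivAt_besselJ ν hy
    have h2 := hasDerivAt_besselJ_add_one ν hy
    have h3 := hasDerivAt_besselJ (-ν - 1) hy
    have h4 := hasDerivAt_besselJ_add_one (-ν - 1) hy
    simp only [sub_add_cancel] at h3 h4
    refine ((hasDerivAt_id y).mul ((h2.mul h4).add (h1.mul h3))).congr_deriv ?_
    simp only [id, Pi.add_apply, Pi.mul_apply]
    field_simp
    ring
  · have e : -(2 * Real.sin (ν * π) / π) =
        0 * ((Real.Gamma (ν + 1 + 1))⁻¹ * (Real.Gamma (-ν + 1))⁻¹) +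
        2 * ((Real.Gamma (ν + 1))⁻¹ * (Real.Gamma (-ν - 1 + 1))⁻¹) := by
      have h := Real.Gamma_mul_Gamma_one_sub (ν + 1)
      rw [show 1 - (ν + 1) = -ν - 1 + 1 by ring] at h
      rw [← mul_inv (Real.Gamma (ν + 1)) (Real.Gamma (-ν - 1 + 1)), h, show π * (ν + 1) = ν * π + π by ring, Real.sin_add_pi, inv_div]
      ring
    rw [e]
    have hx2 : Tendsto (fun x : ℝ => x ^ 2 / 2) (𝓝[>] 0) (𝓝 0) := by
      have : Continuous fun x : ℝ => x ^ 2 / 2 := by fun_prop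
      have h := this.tendsto 0
      norm_num at h
      exact h.mono_left nhdsWithin_le_nhds
    refine ((hx2.mul ((tendsto_entireJ_zero (ν + 1)).mul (tendsto_entireJ_zero (-ν)))).add
      (((tendsto_entireJ_zero ν).mul (tendsto_entireJ_zero (-ν - 1))).const_mul 2)).congr' ?_
    filter_upwards [self_mem_nhdsWithin] with y (hy : 0 < y)
    have hy2 : 0 < y / 2 := by positivity
    simp only [besselJ_eq _ hy]
    rw [Real.rpow_add hy2, Real.rpow_sub hy2, Real.rpow_neg hy2.le, Real.rpow_one]
    field_simp

/-- `ν ↦ J_ν(x)` is real analytic: it is the product of `(x / 2) ^ ν` and a locally uniformly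
convergent series of entire functions of the order. -/
theorem analyticOnNhd_besselJ {x : ℝ} (hx : 0 < x) :
    AnalyticOnNhd ℝ (fun ν => besselJ ν x) univ := by
  let F : ℂ → ℂ := fun z => ∑' k : ℕ, (-1 : ℂ) ^ k / (k.factorial : ℂ) *
    (Complex.Gamma (k + z + 1))⁻¹ * ((x / 2 : ℝ) : ℂ) ^ (2 * k)
  have hF : Differentiable ℂ F := by
    intro z
    obtain ⟨C, hC⟩ := besselJ_inv_gamma_bound (‖z‖ + 1)
    have hd := Complex.differentiableOn_tsum_of_summable_norm
      (U := Metric.ball (0 : ℂ) (‖z‖ + 1)) (F := fun (k : ℕ) z => (-1 : ℂ) ^ k / (k.factorial : ℂ) *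
        (Complex.Gamma (k + z + 1))⁻¹ * ((x / 2 : ℝ) : ℂ) ^ (2 * k))
      (u := fun k => C * (((x / 2) ^ 2) ^ k / (k.factorial : ℝ)))
      ((Real.summable_pow_div_factorial _).mul_left C) ?_ Metric.isOpen_ball ?_
    · exact hd.differentiableAt (Metric.isOpen_ball.mem_nhds (by simp))
    · intro k
      have : Differentiable ℂ fun z : ℂ => (Complex.Gamma (k + z + 1))⁻¹ :=
        Complex.differentiable_one_div_Gamma.comp (by fun_prop)
      exact ((this.const_mul _).mul_const _).differentiableOn
    · intro k w hw
      have hw' : ‖w‖ ≤ ‖z‖ + 1 := by simpa using (Metric.mem_ball.1 hw).le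
      have := hC k w hw'
      have e : ‖((x / 2 : ℝ) : ℂ) ^ (2 * k)‖ = ((x / 2) ^ 2) ^ k := by
        rw [norm_pow, Complex.norm_real, Real.norm_of_nonneg (by positivity), pow_mul]
      rw [norm_mul, norm_mul, e, norm_div, norm_pow, norm_neg, norm_one, one_pow,
        Complex.norm_natCast]
      calc _ ≤ 1 / (k.factorial : ℝ) * C * ((x / 2) ^ 2) ^ k := by gcongr
        _ = _ := by ring
  have hJ : (fun ν => besselJ ν x) = fun ν : ℝ => (F ν).re * (x / 2) ^ ν := by
    funext ν
    have : F ν = (entireJ ν (x ^ 2 / 4) : ℂ) := by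
      rw [entireJ, Complex.ofReal_tsum]
      refine tsum_congr fun k => ?_
      rw [show (k : ℂ) + ν + 1 = ((k + ν + 1 : ℝ) : ℂ) by push_cast; rfl, Complex.Gamma_ofReal,
        div_mul_eq_div_div, div_eq_mul_inv _ (Real.Gamma _), pow_mul]
      push_cast
      rw [show (x : ℂ) ^ 2 / 4 = (x / 2) ^ 2 by ring]
    rw [this, Complex.ofReal_re, besselJ_eq ν hx, mul_comm]
  rw [hJ]
  intro ν _
  have h1 : AnalyticAt ℝ (fun ν : ℝ => (F ν).re) ν :=
    (hF.analyticAt (ν : ℂ)).re_ofReal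
  have h2 : AnalyticAt ℝ (fun ν : ℝ => (x / 2) ^ ν) ν := by
    have : (fun ν : ℝ => (x / 2) ^ ν) = fun ν => Real.exp (Real.log (x / 2) * ν) := by
      funext ν
      rw [Real.rpow_def_of_pos (by positivity)]
    rw [this]
    fun_prop
  exact h1.mul h2

/-! ### The Macdonald functions of order zero and one -/

/-- The Macdonald function of order zero in the variable `q = z² / 4`: `k0 (z² / 4) = 2 K_0(z)`. -/
noncomputable def k0 (q : ℝ) : ℝ := ∫ w in Ioi (0 : ℝ), Real.exp (-w - q / w) / w

/-- The Macdonald function of order one in the variable `q = z² / 4`: `k1 (z² / 4) = z K_1(z)`. -/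
noncomputable def k1 (q : ℝ) : ℝ := ∫ w in Ioi (0 : ℝ), Real.exp (-w - q / w)

theorem integral_Ioi_pos {f : ℝ → ℝ} (hf : IntegrableOn f (Ioi 0)) (h : ∀ t, 0 < t → 0 < f t) :
    0 < ∫ t in Ioi (0 : ℝ), f t := by
  rw [setIntegral_pos_iff_support_of_nonneg_ae]
  · refine lt_of_lt_of_le ?_ (measure_mono (s := Ioi (0 : ℝ)) fun t ht => ⟨(h t ht).ne', ht⟩)
    simp
  · filter_upwards [ae_restrict_mem measurableSet_Ioi] with t ht using (h t ht).le
  · exact hf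

theorem integrableOn_exp_neg : IntegrableOn (fun w : ℝ => Real.exp (-w)) (Ioi 0) := by
  simpa using integrableOn_exp_mul_Ioi (a := -1) (by norm_num) 0

theorem exp_neg_div_le {q w : ℝ} (hq : 0 < q) (hw : 0 < w) :
    Real.exp (-(q / w)) ≤ w / q := by
  rw [Real.exp_neg, ← inv_div q w]
  exact inv_anti₀ (by positivity) ((by linarith : q / w ≤ q / w + 1).trans (Real.add_one_le_exp _))

theorem exp_neg_div_le_sq {q w : ℝ} (hq : 0 < q) (hw : 0 < w) :
    Real.exp (-(q / w)) ≤ 4 * w ^ 2 / q ^ 2 := by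
  have h := exp_neg_div_le (half_pos hq) hw
  have e : Real.exp (-(q / w)) = Real.exp (-(q / 2 / w)) ^ 2 := by
    rw [← Real.exp_nat_mul]; congr 1; push_cast; field_simp
  rw [e]
  calc _ ≤ (w / (q / 2)) ^ 2 := by gcongr
    _ = _ := by field_simp; norm_num

theorem integrableOn_k1 {q : ℝ} (hq : 0 ≤ q) :
    IntegrableOn (fun w : ℝ => Real.exp (-w - q / w)) (Ioi 0) := by
  refine integrableOn_exp_neg.mono'
    (Measurable.aestronglyMeasurable (by fun_prop)) ?_
  filter_upwards [ae_restrict_mem measurableSet_Ioi] with w (hw : 0 < w)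
  rw [Real.norm_of_nonneg (by positivity)]
  have : 0 ≤ q / w := by positivity
  exact Real.exp_le_exp.2 (by linarith)

theorem integrableOn_k0 {q : ℝ} (hq : 0 < q) :
    IntegrableOn (fun w : ℝ => Real.exp (-w - q / w) / w) (Ioi 0) := by
  refine (integrableOn_exp_neg.const_mul (1 / q)).mono'
    (Measurable.aestronglyMeasurable (by fun_prop)) ?_
  filter_upwards [ae_restrict_mem measurableSet_Ioi] with w (hw : 0 < w)
  rw [Real.norm_of_nonneg (by positivity), sub_eq_add_neg, Real.exp_add, div_le_iff₀ hw]
  calc _ ≤ Real.exp (-w) * (w / q) := by gcongr; exact exp_neg_div_le hq hw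
    _ = _ := by ring

theorem integrableOn_deriv_k0 {q : ℝ} (hq : 0 < q) :
    IntegrableOn (fun w : ℝ => Real.exp (-w - q / w) / w ^ 2) (Ioi 0) := by
  refine (integrableOn_exp_neg.const_mul (4 / q ^ 2)).mono'
    (Measurable.aestronglyMeasurable (by fun_prop)) ?_
  filter_upwards [ae_restrict_mem measurableSet_Ioi] with w (hw : 0 < w)
  rw [Real.norm_of_nonneg (by positivity), sub_eq_add_neg, Real.exp_add,
    div_le_iff₀ (by positivity)]
  calc _ ≤ Real.exp (-w) * (4 * w ^ 2 / q ^ 2) := by gcongr; exact exp_neg_div_le_sq hq hw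
    _ = _ := by ring

theorem k0_pos {q : ℝ} (hq : 0 < q) : 0 < k0 q :=
  integral_Ioi_pos (integrableOn_k0 hq) fun w hw => by positivity

theorem k1_pos {q : ℝ} (hq : 0 ≤ q) : 0 < k1 q :=
  integral_Ioi_pos (integrableOn_k1 hq) fun w hw => by positivity

theorem exp_neg_sub_div_le_of_mem_ball {q y w : ℝ} (hw : 0 < w)
    (hy : y ∈ Metric.ball q (q / 2)) : Real.exp (-w - y / w) ≤ Real.exp (-w - q / 2 / w) := by
  rw [Metric.mem_ball, Real.dist_eq, abs_lt] at hy
  have : q / 2 / w ≤ y / w := by gcongr; linarith [hy.1]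
  exact Real.exp_le_exp.2 (by linarith)

theorem hasDerivAt_k1 {q : ℝ} (hq : 0 < q) : HasDerivAt k1 (-k0 q) q := by
  have h := hasDerivAt_integral_of_dominated_loc_of_deriv_le (𝕜 := ℝ)
    (μ := volume.restrict (Ioi (0 : ℝ))) (s := Metric.ball q (q / 2)) (x₀ := q)
    (F := fun q w => Real.exp (-w - q / w)) (F' := fun q w => -(Real.exp (-w - q / w) / w))
    (bound := fun w => Real.exp (-w - q / 2 / w) / w)
    (Metric.ball_mem_nhds q (half_pos hq)) (Eventually.of_forall fun _ => Measurable.aestronglyMeasurable (by fun_prop))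
    (integrableOn_k1 hq.le) (Measurable.aestronglyMeasurable (by fun_prop)) ?_ (integrableOn_k0 (half_pos hq)) ?_
  · have h2 := h.2
    rw [integral_neg] at h2
    exact h2
  · filter_upwards [ae_restrict_mem measurableSet_Ioi] with w (hw : 0 < w) y hy
    rw [norm_neg, Real.norm_of_nonneg (by positivity)]
    gcongr ?_ / _
    exact exp_neg_sub_div_le_of_mem_ball hw hy
  · filter_upwards [ae_restrict_mem measurableSet_Ioi] with w (hw : 0 < w) y hy
    refine (((hasDerivAt_id y).div_const w).const_sub (-w)).exp.congr_deriv ?_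
    simp only [id]
    ring

/-- The integrals of `exp (-w - q / w)` and of `q exp (-w - q / w) / w²` agree, because their
difference is the integral of the derivative of `exp (-w - q / w)`. -/
theorem mul_integral_deriv_k0 {q : ℝ} (hq : 0 < q) :
    q * ∫ w in Ioi (0 : ℝ), Real.exp (-w - q / w) / w ^ 2 = k1 q := by
  have hu : ∀ w ∈ Ioi (0 : ℝ), HasDerivAt (fun w => Real.exp (-(q / w)))
      (Real.exp (-(q / w)) * (q / w ^ 2)) w := fun w hw => by
    have := ((hasDerivAt_inv (ne_of_gt hw)).const_mul q).neg.exp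
    refine this.congr_deriv ?_
    simp only [Pi.neg_apply]
    ring_nf
  have hv : ∀ w ∈ Ioi (0 : ℝ), HasDerivAt (fun w => Real.exp (-w)) (Real.exp (-w) * -1) w :=
    fun w _ => (hasDerivAt_neg w).exp
  have i1 := (integrableOn_deriv_k0 hq).const_mul q
  have i2 := integrableOn_k1 hq.le
  have e : ∀ w : ℝ, Real.exp (-(q / w)) * (q / w ^ 2) * Real.exp (-w) +
      Real.exp (-(q / w)) * (Real.exp (-w) * -1) =
      q * (Real.exp (-w - q / w) / w ^ 2) - Real.exp (-w - q / w) := fun w => by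
    rw [sub_eq_add_neg (-w), Real.exp_add]; ring
  have h := integral_Ioi_deriv_mul_eq_sub (a := 0) (a' := 0) (b' := 0) hu hv ?_ ?_ ?_
  · simp only [e] at h
    rw [integral_sub i1 i2, integral_const_mul, sub_zero, sub_eq_zero] at h
    exact h
  · refine (i1.sub i2).congr (Eventually.of_forall fun w => ?_)
    simp only [Pi.add_apply, Pi.mul_apply, Pi.sub_apply]
    exact (e w).symm
  · refine squeeze_zero' (g := fun w => w / q) ?_ ?_ ?_
    · exact Eventually.of_forall fun w => by simp only [Pi.mul_apply]; positivity
    · filter_upwards [self_mem_nhdsWithin] with w (hw : 0 < w)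
      simp only [Pi.mul_apply]
      calc _ ≤ w / q * 1 := by
            gcongr
            · exact exp_neg_div_le hq hw
            · exact Real.exp_le_one_iff.2 (by linarith)
        _ = _ := by ring
    · have : Continuous fun w : ℝ => w / q := by fun_prop
      have h := this.tendsto 0
      norm_num at h
      exact h.mono_left nhdsWithin_le_nhds
  · refine squeeze_zero' (g := fun w => Real.exp (-w)) ?_ ?_ Real.tendsto_exp_neg_atTop_nhds_zero
    · exact Eventually.of_forall fun w => by simp only [Pi.mul_apply]; positivity
    · filter_upwards [eventually_gt_atTop 0] with w hw
      simp only [Pi.mul_apply]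
      refine mul_le_of_le_one_left (by positivity) (Real.exp_le_one_iff.2 ?_)
      have : 0 ≤ q / w := by positivity
      linarith

theorem hasDerivAt_k0 {q : ℝ} (hq : 0 < q) : HasDerivAt k0 (-(k1 q / q)) q := by
  have h := hasDerivAt_integral_of_dominated_loc_of_deriv_le (𝕜 := ℝ)
    (μ := volume.restrict (Ioi (0 : ℝ))) (s := Metric.ball q (q / 2)) (x₀ := q)
    (F := fun q w => Real.exp (-w - q / w) / w) (F' := fun q w => -(Real.exp (-w - q / w) / w ^ 2))
    (bound := fun w => Real.exp (-w - q / 2 / w) / w ^ 2)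
    (Metric.ball_mem_nhds q (half_pos hq)) (Eventually.of_forall fun _ => Measurable.aestronglyMeasurable (by fun_prop))
    (integrableOn_k0 hq) (Measurable.aestronglyMeasurable (by fun_prop)) ?_ (integrableOn_deriv_k0 (half_pos hq)) ?_
  · have h2 := h.2
    rw [integral_neg] at h2
    rw [← mul_integral_deriv_k0 hq, mul_div_cancel_left₀ _ hq.ne']
    exact h2
  · filter_upwards [ae_restrict_mem measurableSet_Ioi] with w (hw : 0 < w) y hy
    rw [norm_neg, Real.norm_of_nonneg (by positivity)]
    gcongr ?_ / _
    exact exp_neg_sub_div_le_of_mem_ball hw hy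
  · filter_upwards [ae_restrict_mem measurableSet_Ioi] with w (hw : 0 < w) y hy
    refine ((((hasDerivAt_id y).div_const w).const_sub (-w)).exp.div_const w).congr_deriv ?_
    simp only [id]
    field_simp

theorem continuousOn_k0 : ContinuousOn k0 (Ioi 0) :=
  fun _ hq => (hasDerivAt_k0 hq).continuousAt.continuousWithinAt

theorem continuousOn_k1 : ContinuousOn k1 (Ioi 0) :=
  fun _ hq => (hasDerivAt_k1 hq).continuousAt.continuousWithinAt

/-- The exponential factor of the Macdonald functions comes from `w + z² / w ≥ 2 z`; half of the
exponent is kept to leave an integrable function of `w`. -/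
theorem exp_neg_sub_sq_div_le {z w : ℝ} (hw : 0 < w) :
    Real.exp (-w - z ^ 2 / w) ≤
      Real.exp (-z) * (Real.exp (-(w / 2)) * Real.exp (-(z ^ 2 / w / 2))) := by
  rw [← Real.exp_add, ← Real.exp_add]
  refine Real.exp_le_exp.2 ?_
  have h : 2 * z ≤ w + z ^ 2 / w := by
    have h1 : w + z ^ 2 / w - 2 * z = (w - z) ^ 2 / w := by field_simp; ring
    have h2 : 0 ≤ (w - z) ^ 2 / w := by positivity
    linarith
  linarith

theorem integral_exp_neg_half : ∫ w in Ioi (0 : ℝ), Real.exp (-(w / 2)) = 2 := by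
  have := integral_exp_mul_Ioi (a := -(1 / 2)) (by norm_num) 0
  norm_num at this
  refine Eq.trans (integral_congr_ae (Eventually.of_forall fun w => ?_)) this
  simp only
  ring_nf

theorem integrableOn_exp_neg_half : IntegrableOn (fun w : ℝ => Real.exp (-(w / 2))) (Ioi 0) := by
  refine (integrableOn_exp_mul_Ioi (a := -(1 / 2)) (by norm_num) 0).congr
    (Eventually.of_forall fun w => ?_)
  simp only
  ring_nf

theorem k1_sq_le (z : ℝ) : k1 (z ^ 2) ≤ 2 * Real.exp (-z) := by
  rw [k1, mul_comm, ← integral_exp_neg_half, ← integral_const_mul]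
  refine setIntegral_mono_on (integrableOn_k1 (sq_nonneg z))
    (integrableOn_exp_neg_half.const_mul _) measurableSet_Ioi fun w (hw : 0 < w) => ?_
  refine (exp_neg_sub_sq_div_le hw).trans ?_
  gcongr
  refine mul_le_of_le_one_right (by positivity) (Real.exp_le_one_iff.2 ?_)
  have : 0 ≤ z ^ 2 / w / 2 := by positivity
  linarith

theorem exists_k0_sq_le : ∃ C : ℝ, 0 ≤ C ∧ ∀ z : ℝ, 0 < z →
    k0 (z ^ 2) ≤ C * (z ^ (-(1 / 2) : ℝ) * Real.exp (-z)) := by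
  have hi : IntegrableOn (fun w : ℝ => Real.exp (-(w / 2)) * w ^ (-(3 / 4) : ℝ)) (Ioi 0) := by
    have := integrableOn_rpow_mul_exp_neg_mul_rpow (p := 1) (s := -(3 / 4)) (b := 1 / 2)
      (by norm_num) one_pos (by norm_num)
    refine this.congr (Eventually.of_forall fun w => ?_)
    simp only [Real.rpow_one]
    rw [mul_comm]
    ring_nf
  refine ⟨∫ w in Ioi (0 : ℝ), Real.exp (-(w / 2)) * w ^ (-(3 / 4) : ℝ),
    setIntegral_nonneg measurableSet_Ioi fun w (hw : 0 < w) => by positivity, fun z hz => ?_⟩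
  rw [k0, mul_comm, ← integral_const_mul]
  refine setIntegral_mono_on (integrableOn_k0 (by positivity))
    (hi.const_mul _) measurableSet_Ioi fun w (hw : 0 < w) => ?_
  have h1 : Real.exp (-(z ^ 2 / w / 2)) ≤ (z ^ 2 / w) ^ (-(1 / 4) : ℝ) := by
    have hy : 0 < z ^ 2 / w := by positivity
    rw [Real.rpow_def_of_pos hy]
    refine Real.exp_le_exp.2 ?_
    have := Real.log_le_sub_one_of_pos hy
    linarith
  have h2 : (z ^ 2 / w) ^ (-(1 / 4) : ℝ) = z ^ (-(1 / 2) : ℝ) * w ^ (1 / 4 : ℝ) := by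
    rw [Real.div_rpow (by positivity) hw.le, ← Real.rpow_natCast, ← Real.rpow_mul hz.le,
      Real.rpow_neg hw.le (1 / 4), div_inv_eq_mul]
    norm_num
  have h3 : w ^ (1 / 4 : ℝ) / w = w ^ (-(3 / 4) : ℝ) := by
    rw [← Real.rpow_sub_one hw.ne']
    norm_num
  calc Real.exp (-w - z ^ 2 / w) / w
      ≤ Real.exp (-z) * (Real.exp (-(w / 2)) * Real.exp (-(z ^ 2 / w / 2))) / w := by
        gcongr; exact exp_neg_sub_sq_div_le hw
    _ ≤ Real.exp (-z) * (Real.exp (-(w / 2)) * (z ^ (-(1 / 2) : ℝ) * w ^ (1 / 4 : ℝ))) / w := by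
        gcongr; exact h1.trans_eq h2
    _ = _ := by rw [← h3]; ring

/-- The Mellin transform of `K_0`, with the integrability that justifies it. -/
theorem mellin_k0 {s : ℝ} (hs : 0 < s) :
    IntegrableOn (fun y : ℝ => k0 (y ^ 2 / 4) * y ^ (2 * s - 1)) (Ioi 0) ∧
    ∫ y in Ioi (0 : ℝ), k0 (y ^ 2 / 4) * y ^ (2 * s - 1) = 4 ^ s * Real.Gamma s ^ 2 / 2 := by
  let G : ℝ → ℝ → ℝ := fun y w => Real.exp (-w - y ^ 2 / 4 / w) / w * y ^ (2 * s - 1)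
  have hin : ∀ w : ℝ, 0 < w → (IntegrableOn (fun y => G y w) (Ioi 0) ∧
      ∫ y in Ioi (0 : ℝ), G y w = 4 ^ s * Real.Gamma s / 2 * (Real.exp (-w) * w ^ (s - 1))) := by
    intro w hw
    have e : ∀ y, G y w = Real.exp (-w) / w *
        (y ^ (2 * s - 1) * Real.exp (-(1 / (4 * w)) * y ^ (2 : ℝ))) := fun y => by
      simp only [G]
      rw [sub_eq_add_neg, Real.exp_add, Real.rpow_two]
      field_simp
    simp only [e]
    refine ⟨(integrableOn_rpow_mul_exp_neg_mul_rpow (by linarith) (by norm_num)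
      (by positivity)).const_mul _, ?_⟩
    rw [integral_const_mul, integral_rpow_mul_exp_neg_mul_rpow (by norm_num) (by linarith)
      (by positivity), one_div, Real.inv_rpow (by positivity), Real.mul_rpow (by norm_num) hw.le,
      show -(2 * s - 1 + 1) / 2 = -s by ring, show (2 * s - 1 + 1) / 2 = s by ring,
      Real.rpow_neg (by norm_num), Real.rpow_neg hw.le, Real.rpow_sub_one hw.ne']
    field_simp
  have hmeas : Measurable (Function.uncurry G) := by
    simp only [G, Function.uncurry_def]
    fun_prop
  have hout : IntegrableOn (fun w : ℝ => 4 ^ s * Real.Gamma s / 2 *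
      (Real.exp (-w) * w ^ (s - 1))) (Ioi 0) :=
    (Real.GammaIntegral_convergent hs).const_mul _
  have hint : Integrable (Function.uncurry G)
      ((volume.restrict (Ioi (0 : ℝ))).prod (volume.restrict (Ioi (0 : ℝ)))) := by
    rw [integrable_prod_iff' hmeas.aestronglyMeasurable]
    constructor
    · filter_upwards [ae_restrict_mem measurableSet_Ioi] with w hw using (hin w hw).1
    · refine hout.congr ?_
      filter_upwards [ae_restrict_mem measurableSet_Ioi] with w (hw : 0 < w)
      rw [← (hin w hw).2]
      refine setIntegral_congr_fun measurableSet_Ioi fun y (hy : 0 < y) => ?_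
      simp only [G, Function.uncurry]
      rw [Real.norm_of_nonneg (by positivity)]
  have hk : ∀ y, ∫ w in Ioi (0 : ℝ), G y w = k0 (y ^ 2 / 4) * y ^ (2 * s - 1) := fun y =>
    integral_mul_const _ _
  constructor
  · have := hint.integral_prod_left
    simp only [Function.uncurry, hk] at this
    exact this
  · simp only [← hk]
    rw [integral_integral_swap hint, setIntegral_congr_fun measurableSet_Ioi
      fun w hw => (hin w hw).2, integral_const_mul, ← Real.Gamma_eq_integral hs]
    ring

/-! ### Nicholson's integrals -/

/-- Nicholson's integral `(8 / π²) ∫₀^∞ K_0(2 x sinh t) cosh (2 ν t) dt`, which turns out to be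
`J_ν(x)² + Y_ν(x)²`. -/
noncomputable def modSq (ν x : ℝ) : ℝ :=
  4 / π ^ 2 * ∫ t in Ioi (0 : ℝ), k0 ((x * Real.sinh t) ^ 2) * Real.cosh (2 * ν * t)

/-- The integral `-(x / 2) (d / dx) modSq ν x`. -/
noncomputable def modDeriv (ν x : ℝ) : ℝ :=
  4 / π ^ 2 * ∫ t in Ioi (0 : ℝ), k1 ((x * Real.sinh t) ^ 2) * Real.cosh (2 * ν * t)

/-- The function that turns out to be `J_ν(x) J_{ν+1}(x) + Y_ν(x) Y_{ν+1}(x)`. -/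
noncomputable def modCross (ν x : ℝ) : ℝ := (ν * modSq ν x + modDeriv ν x) / x

theorem modSq_neg (ν x : ℝ) : modSq (-ν) x = modSq ν x := by
  simp only [modSq, mul_neg, neg_mul, Real.cosh_neg]

theorem sq_div_four_le_sinh {t : ℝ} (ht : 0 ≤ t) : t ^ 2 / 4 ≤ Real.sinh t := by
  have h1 := Real.quadratic_le_exp_of_nonneg ht
  have h2 : Real.exp (-t) ≤ 1 := Real.exp_le_one_iff.2 (by linarith)
  rw [Real.sinh_eq]
  linarith

theorem exp_mul_exp_neg_sinh_le {x : ℝ} (hx : 0 < x) (b : ℝ) {t : ℝ} (ht : 0 ≤ t) :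
    Real.exp (b * t) * Real.exp (-(x * Real.sinh t)) ≤
      Real.exp ((b + 1) ^ 2 / x) * Real.exp (-t) := by
  rw [← Real.exp_add, ← Real.exp_add]
  refine Real.exp_le_exp.2 ?_
  have h1 : x * (t ^ 2 / 4) ≤ x * Real.sinh t := by
    gcongr; exact sq_div_four_le_sinh ht
  have h2 : (b + 1) ^ 2 / x + x * (t ^ 2 / 4) - (b + 1) * t = ((b + 1) - x * t / 2) ^ 2 / x := by
    field_simp; ring
  have h3 : 0 ≤ ((b + 1) - x * t / 2) ^ 2 / x := by positivity
  linarith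

theorem integrableOn_exp_mul_exp_neg_sinh {x : ℝ} (hx : 0 < x) (b : ℝ) :
    IntegrableOn (fun t => Real.exp (b * t) * Real.exp (-(x * Real.sinh t))) (Ioi 0) := by
  refine (integrableOn_exp_neg.const_mul (Real.exp ((b + 1) ^ 2 / x))).mono'
    (Continuous.aestronglyMeasurable (by fun_prop)) ?_
  filter_upwards [ae_restrict_mem measurableSet_Ioi] with t (ht : 0 < t)
  rw [Real.norm_of_nonneg (by positivity)]
  exact exp_mul_exp_neg_sinh_le hx b ht.le

theorem integrableOn_rpow_mul_exp_mul_exp_neg_sinh {x : ℝ} (hx : 0 < x) (b : ℝ) :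
    IntegrableOn (fun t => t ^ (-(1 / 2) : ℝ) *
      (Real.exp (b * t) * Real.exp (-(x * Real.sinh t)))) (Ioi 0) := by
  have hG := (Real.GammaIntegral_convergent (s := 1 / 2) (by norm_num)).const_mul
    (Real.exp ((b + 1) ^ 2 / x))
  refine hG.mono' (Measurable.aestronglyMeasurable (by fun_prop)) ?_
  filter_upwards [ae_restrict_mem measurableSet_Ioi] with t (ht : 0 < t)
  rw [Real.norm_of_nonneg (by positivity)]
  calc _ ≤ t ^ (-(1 / 2) : ℝ) * (Real.exp ((b + 1) ^ 2 / x) * Real.exp (-t)) := by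
        exact mul_le_mul_of_nonneg_left (exp_mul_exp_neg_sinh_le hx b ht.le) (by positivity)
    _ = _ := by norm_num; ring

theorem continuousOn_k0_sinh {x : ℝ} (hx : 0 < x) :
    ContinuousOn (fun t => k0 ((x * Real.sinh t) ^ 2)) (Ioi 0) :=
  continuousOn_k0.comp (by fun_prop) fun t (ht : 0 < t) => by
    have := Real.sinh_pos_iff.2 ht
    simp only [mem_Ioi]
    positivity

theorem continuousOn_k1_sinh {x : ℝ} (hx : 0 < x) :
    ContinuousOn (fun t => k1 ((x * Real.sinh t) ^ 2)) (Ioi 0) :=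
  continuousOn_k1.comp (by fun_prop) fun t (ht : 0 < t) => by
    have := Real.sinh_pos_iff.2 ht
    simp only [mem_Ioi]
    positivity

theorem aestronglyMeasurable_k0_sinh {x : ℝ} (hx : 0 < x) :
    AEStronglyMeasurable (fun t => k0 ((x * Real.sinh t) ^ 2)) (volume.restrict (Ioi 0)) :=
  (continuousOn_k0_sinh hx).aestronglyMeasurable measurableSet_Ioi

theorem aestronglyMeasurable_k1_sinh {x : ℝ} (hx : 0 < x) :
    AEStronglyMeasurable (fun t => k1 ((x * Real.sinh t) ^ 2)) (volume.restrict (Ioi 0)) :=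
  (continuousOn_k1_sinh hx).aestronglyMeasurable measurableSet_Ioi

theorem integrableOn_k0_mul_exp {x : ℝ} (hx : 0 < x) (b : ℝ) :
    IntegrableOn (fun t => k0 ((x * Real.sinh t) ^ 2) * Real.exp (b * t)) (Ioi 0) := by
  obtain ⟨C, hC0, hC⟩ := exists_k0_sq_le
  refine ((integrableOn_rpow_mul_exp_mul_exp_neg_sinh hx b).const_mul
    (C * x ^ (-(1 / 2) : ℝ))).mono' ((aestronglyMeasurable_k0_sinh hx).mul
    (Continuous.aestronglyMeasurable (by fun_prop))) ?_
  filter_upwards [ae_restrict_mem measurableSet_Ioi] with t (ht : 0 < t)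
  have hs := Real.sinh_pos_iff.2 ht
  have hk := k0_pos (q := (x * Real.sinh t) ^ 2) (by positivity)
  rw [Real.norm_of_nonneg (by positivity)]
  have h1 := hC (x * Real.sinh t) (by positivity)
  have h2 : (x * Real.sinh t) ^ (-(1 / 2) : ℝ) ≤ x ^ (-(1 / 2) : ℝ) * t ^ (-(1 / 2) : ℝ) := by
    rw [Real.mul_rpow hx.le hs.le]
    exact mul_le_mul_of_nonneg_left (Real.rpow_le_rpow_of_nonpos ht
      (Real.self_le_sinh_iff.2 ht.le) (by norm_num)) (by positivity)
  calc _ ≤ C * ((x * Real.sinh t) ^ (-(1 / 2) : ℝ) * Real.exp (-(x * Real.sinh t))) *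
        Real.exp (b * t) := by gcongr
    _ ≤ C * ((x ^ (-(1 / 2) : ℝ) * t ^ (-(1 / 2) : ℝ)) * Real.exp (-(x * Real.sinh t))) *
        Real.exp (b * t) := by gcongr
    _ = _ := by ring

theorem integrableOn_k1_mul_exp {x : ℝ} (hx : 0 < x) (b : ℝ) :
    IntegrableOn (fun t => k1 ((x * Real.sinh t) ^ 2) * Real.exp (b * t)) (Ioi 0) := by
  refine ((integrableOn_exp_mul_exp_neg_sinh hx b).const_mul 2).mono'
    ((aestronglyMeasurable_k1_sinh hx).mul (Continuous.aestronglyMeasurable (by fun_prop))) ?_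
  filter_upwards with t
  have hk := k1_pos (q := (x * Real.sinh t) ^ 2) (by positivity)
  rw [Real.norm_of_nonneg (by positivity)]
  calc _ ≤ 2 * Real.exp (-(x * Real.sinh t)) * Real.exp (b * t) := by
        gcongr; exact k1_sq_le _
    _ = _ := by ring

theorem cosh_eq_exp_add (ν t : ℝ) : Real.cosh (2 * ν * t) =
    (Real.exp (2 * ν * t) + Real.exp (-(2 * ν) * t)) / 2 := by
  rw [Real.cosh_eq, neg_mul (2 * ν)]

theorem integrableOn_mul_cosh {g : ℝ → ℝ}
    (hg : ∀ b : ℝ, IntegrableOn (fun t => g t * Real.exp (b * t)) (Ioi 0)) (ν : ℝ) :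
    IntegrableOn (fun t => g t * Real.cosh (2 * ν * t)) (Ioi 0) := by
  refine (((hg (2 * ν)).add (hg (-(2 * ν)))).div_const 2).congr (Eventually.of_forall fun t => ?_)
  simp only [cosh_eq_exp_add, Pi.add_apply]
  ring

theorem integrableOn_modSq {x : ℝ} (hx : 0 < x) (ν : ℝ) : IntegrableOn (fun t =>
    k0 ((x * Real.sinh t) ^ 2) * Real.cosh (2 * ν * t)) (Ioi 0) :=
  integrableOn_mul_cosh (integrableOn_k0_mul_exp hx) ν

theorem integrableOn_modDeriv {x : ℝ} (hx : 0 < x) (ν : ℝ) : IntegrableOn (fun t =>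
    k1 ((x * Real.sinh t) ^ 2) * Real.cosh (2 * ν * t)) (Ioi 0) :=
  integrableOn_mul_cosh (integrableOn_k1_mul_exp hx) ν

theorem modSq_pos (ν : ℝ) {x : ℝ} (hx : 0 < x) : 0 < modSq ν x := by
  refine mul_pos (by positivity) (integral_Ioi_pos (integrableOn_modSq hx ν) fun t ht => ?_)
  have hs := Real.sinh_pos_iff.2 ht
  exact mul_pos (k0_pos (by positivity)) (Real.cosh_pos _)

theorem modDeriv_pos (ν : ℝ) {x : ℝ} (hx : 0 < x) : 0 < modDeriv ν x := by
  refine mul_pos (by positivity) (integral_Ioi_pos (integrableOn_modDeriv hx ν) fun t ht => ?_)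
  exact mul_pos (k1_pos (by positivity)) (Real.cosh_pos _)

theorem modCross_pos {ν : ℝ} (hν : 0 ≤ ν) {x : ℝ} (hx : 0 < x) : 0 < modCross ν x := by
  have h1 := modSq_pos ν hx
  have h2 := modDeriv_pos ν hx
  exact div_pos (by positivity) hx

theorem modSq_lt_modSq {μ ν : ℝ} (hμ : 0 ≤ μ) (h : μ < ν) {x : ℝ} (hx : 0 < x) :
    modSq μ x < modSq ν x := by
  rw [modSq, modSq]
  refine mul_lt_mul_of_pos_left ?_ (by positivity)
  rw [← sub_pos, ← integral_sub (integrableOn_modSq hx ν) (integrableOn_modSq hx μ)]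
  refine integral_Ioi_pos ((integrableOn_modSq hx ν).sub (integrableOn_modSq hx μ)) fun t ht => ?_
  have hs := Real.sinh_pos_iff.2 ht
  rw [← mul_sub]
  refine mul_pos (k0_pos (by positivity)) (sub_pos.2 (Real.cosh_lt_cosh.2 ?_))
  have hν : 0 < ν := hμ.trans_lt h
  rw [abs_of_nonneg (by positivity), abs_of_nonneg (by positivity)]
  gcongr

/-! ### The differential system of Nicholson's integrals -/

theorem cosh_le_exp_abs_mul (ν : ℝ) {t : ℝ} (ht : 0 ≤ t) :
    Real.cosh (2 * ν * t) ≤ Real.exp (|2 * ν| * t) := by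
  rw [← Real.cosh_abs, abs_mul, abs_of_nonneg ht, ← Real.cosh_add_sinh]
  have : 0 ≤ Real.sinh (|2 * ν| * t) := Real.sinh_nonneg_iff.2 (by positivity)
  linarith

theorem hasDerivAt_modSq (ν : ℝ) {x : ℝ} (hx : 0 < x) :
    HasDerivAt (modSq ν) (-(2 * modDeriv ν x / x)) x := by
  have h := hasDerivAt_integral_of_dominated_loc_of_deriv_le (𝕜 := ℝ)
    (μ := volume.restrict (Ioi (0 : ℝ))) (s := Metric.ball x (x / 2)) (x₀ := x)
    (F := fun x t => k0 ((x * Real.sinh t) ^ 2) * Real.cosh (2 * ν * t))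
    (F' := fun x t => -2 / x * (k1 ((x * Real.sinh t) ^ 2) * Real.cosh (2 * ν * t)))
    (bound := fun t => 8 / x * (Real.exp (|2 * ν| * t) * Real.exp (-(x / 2 * Real.sinh t))))
    (Metric.ball_mem_nhds x (half_pos hx)) ?_
    (integrableOn_modSq hx ν) ((integrableOn_modDeriv hx ν).const_mul _).aestronglyMeasurable ?_
    ((integrableOn_exp_mul_exp_neg_sinh (half_pos hx) _).const_mul _) ?_
  · refine (h.2.const_mul (4 / π ^ 2)).congr_deriv ?_
    rw [integral_const_mul, modDeriv]
    ring
  · filter_upwards [lt_mem_nhds hx] with y hy using (integrableOn_modSq hy ν).aestronglyMeasurable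
  · filter_upwards [ae_restrict_mem measurableSet_Ioi] with t (ht : 0 < t) y hy
    rw [Metric.mem_ball, Real.dist_eq, abs_lt] at hy
    have hy1 : x / 2 ≤ y := by linarith [hy.1]
    have hy0 : 0 < y := by linarith
    have hs := Real.sinh_pos_iff.2 ht
    have hk := k1_pos (q := (y * Real.sinh t) ^ 2) (by positivity)
    have hc := Real.cosh_pos (2 * ν * t)
    rw [norm_mul, Real.norm_of_nonneg (mul_pos hk hc).le, norm_div, norm_neg,
      Real.norm_of_nonneg hy0.le, Real.norm_ofNat]
    calc _ ≤ 2 / (x / 2) * (2 * Real.exp (-(y * Real.sinh t)) * Real.exp (|2 * ν| * t)) := by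
          gcongr
          · exact k1_sq_le _
          · exact cosh_le_exp_abs_mul ν ht.le
      _ ≤ 2 / (x / 2) * (2 * Real.exp (-(x / 2 * Real.sinh t)) * Real.exp (|2 * ν| * t)) := by
          gcongr
      _ = _ := by ring
  · filter_upwards [ae_restrict_mem measurableSet_Ioi] with t (ht : 0 < t) y hy
    rw [Metric.mem_ball, Real.dist_eq, abs_lt] at hy
    have hy0 : 0 < y := by linarith [hy.1]
    have hs := Real.sinh_pos_iff.2 ht
    have hq : HasDerivAt (fun y => (y * Real.sinh t) ^ 2) (2 * (y * Real.sinh t) * Real.sinh t) y :=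
      by simpa using ((hasDerivAt_id y).mul_const (Real.sinh t)).fun_pow 2
    refine (((hasDerivAt_k0 (q := (y * Real.sinh t) ^ 2) (by positivity)).comp y hq).mul_const
      _).congr_deriv ?_
    field_simp

theorem exists_mul_k0_sq_le : ∃ C : ℝ, 0 ≤ C ∧ ∀ z : ℝ, 0 < z →
    z * k0 (z ^ 2) ≤ C * Real.exp (-(z / 2)) := by
  obtain ⟨C, hC0, hC⟩ := exists_k0_sq_le
  refine ⟨C, hC0, fun z hz => ?_⟩
  have h1 : z ^ (1 / 2 : ℝ) ≤ Real.exp (z / 2) := by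
    rw [Real.rpow_def_of_pos hz]
    refine Real.exp_le_exp.2 ?_
    have := Real.log_le_sub_one_of_pos hz
    linarith
  calc z * k0 (z ^ 2) ≤ z * (C * (z ^ (-(1 / 2) : ℝ) * Real.exp (-z))) := by
        gcongr; exact hC z hz
    _ = C * ((z * z ^ (-(1 / 2) : ℝ)) * Real.exp (-z)) := by ring
    _ = C * (z ^ (1 / 2 : ℝ) * Real.exp (-z)) := by
        rw [← Real.rpow_one_add' hz.le (by norm_num)]; norm_num
    _ ≤ C * (Real.exp (z / 2) * Real.exp (-z)) := by gcongr
    _ = _ := by rw [← Real.exp_add]; ring_nf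

theorem sinh_le_exp (t : ℝ) : Real.sinh t ≤ Real.exp t := by
  rw [← Real.cosh_add_sinh]
  linarith [Real.cosh_pos t]

theorem integrableOn_k0_mul_sinh_mul {x : ℝ} (hx : 0 < x) {f : ℝ → ℝ} (hf : Continuous f)
    {b : ℝ} (hb : ∀ t, 0 < t → |f t| ≤ Real.exp (b * t)) :
    IntegrableOn (fun t => k0 ((x * Real.sinh t) ^ 2) * Real.sinh t * f t) (Ioi 0) := by
  obtain ⟨C, hC0, hC⟩ := exists_mul_k0_sq_le
  refine ((integrableOn_exp_mul_exp_neg_sinh (half_pos hx) b).const_mul (C / x)).mono'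
    (((aestronglyMeasurable_k0_sinh hx).mul (Real.continuous_sinh.aestronglyMeasurable)).mul
    hf.aestronglyMeasurable) ?_
  filter_upwards [ae_restrict_mem measurableSet_Ioi] with t (ht : 0 < t)
  have hs := Real.sinh_pos_iff.2 ht
  have hk := k0_pos (q := (x * Real.sinh t) ^ 2) (by positivity)
  rw [norm_mul, Real.norm_of_nonneg (mul_pos hk hs).le, Real.norm_eq_abs]
  have h1 := hC (x * Real.sinh t) (by positivity)
  calc _ ≤ (C * Real.exp (-(x * Real.sinh t / 2)) / x) * Real.exp (b * t) := by
        gcongr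
        · rw [le_div_iff₀ hx]; linarith
        · exact hb t ht
    _ = _ := by rw [show x * Real.sinh t / 2 = x / 2 * Real.sinh t by ring]; ring

theorem cosh_le_exp_of_nonneg {t : ℝ} (ht : 0 ≤ t) : Real.cosh t ≤ Real.exp t := by
  rw [← Real.cosh_add_sinh]
  linarith [Real.sinh_nonneg_iff.2 ht]

theorem abs_sinh_mul_cosh_le (ν : ℝ) {t : ℝ} (ht : 0 < t) :
    |Real.sinh t * Real.cosh (2 * ν * t)| ≤ Real.exp ((1 + |2 * ν|) * t) := by
  have hs := Real.sinh_pos_iff.2 ht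
  rw [abs_mul, abs_of_pos hs, abs_of_pos (Real.cosh_pos _), add_mul, Real.exp_add, one_mul]
  gcongr
  · exact sinh_le_exp t
  · exact cosh_le_exp_abs_mul ν ht.le

theorem abs_cosh_mul_sinh_le (ν : ℝ) {t : ℝ} (ht : 0 < t) :
    |Real.cosh t * Real.sinh (2 * ν * t)| ≤ Real.exp ((1 + |2 * ν|) * t) := by
  rw [abs_mul, abs_of_pos (Real.cosh_pos _), add_mul, Real.exp_add, one_mul]
  gcongr
  · exact cosh_le_exp_of_nonneg ht.le
  · refine le_trans ?_ (cosh_le_exp_abs_mul ν ht.le)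
    rw [Real.abs_sinh, ← Real.cosh_abs (2 * ν * t)]
    exact (Real.sinh_lt_cosh _).le

theorem hasDerivAt_modDeriv (ν : ℝ) {x : ℝ} (hx : 0 < x) :
    HasDerivAt (modDeriv ν) (-(4 / π ^ 2 * (2 * x * ∫ t in Ioi (0 : ℝ),
      k0 ((x * Real.sinh t) ^ 2) * Real.sinh t * (Real.sinh t * Real.cosh (2 * ν * t))))) x := by
  obtain ⟨C, hC0, hC⟩ := exists_mul_k0_sq_le
  have h := hasDerivAt_integral_of_dominated_loc_of_deriv_le (𝕜 := ℝ)
    (μ := volume.restrict (Ioi (0 : ℝ))) (s := Metric.ball x (x / 2)) (x₀ := x)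
    (F := fun x t => k1 ((x * Real.sinh t) ^ 2) * Real.cosh (2 * ν * t))
    (F' := fun x t => -(2 * x) *
      (k0 ((x * Real.sinh t) ^ 2) * Real.sinh t * (Real.sinh t * Real.cosh (2 * ν * t))))
    (bound := fun t => 2 * C * (Real.exp ((1 + |2 * ν|) * t) * Real.exp (-(x / 4 * Real.sinh t))))
    (Metric.ball_mem_nhds x (half_pos hx)) ?_ (integrableOn_modDeriv hx ν)
    ((integrableOn_k0_mul_sinh_mul hx (by fun_prop) fun t ht =>
      abs_sinh_mul_cosh_le ν ht).const_mul _).aestronglyMeasurable ?_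
    ((integrableOn_exp_mul_exp_neg_sinh (by positivity) _).const_mul _) ?_
  · refine (h.2.const_mul (4 / π ^ 2)).congr_deriv ?_
    rw [integral_const_mul]
    ring
  · filter_upwards [lt_mem_nhds hx] with y hy
      using (integrableOn_modDeriv hy ν).aestronglyMeasurable
  · filter_upwards [ae_restrict_mem measurableSet_Ioi] with t (ht : 0 < t) y hy
    rw [Metric.mem_ball, Real.dist_eq, abs_lt] at hy
    have hy1 : x / 2 ≤ y := by linarith [hy.1]
    have hy0 : 0 < y := by linarith
    have hs := Real.sinh_pos_iff.2 ht
    have hk := k0_pos (q := (y * Real.sinh t) ^ 2) (by positivity)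
    rw [norm_mul, norm_mul, Real.norm_of_nonneg (mul_pos hk hs).le, norm_neg,
      Real.norm_of_nonneg (by positivity), Real.norm_eq_abs]
    have h1 := hC (y * Real.sinh t) (by positivity)
    have h2 : y * Real.sinh t / 2 ≥ x / 4 * Real.sinh t := by nlinarith
    calc _ = 2 * (y * Real.sinh t * k0 ((y * Real.sinh t) ^ 2)) *
          |Real.sinh t * Real.cosh (2 * ν * t)| := by ring
      _ ≤ 2 * (C * Real.exp (-(y * Real.sinh t / 2))) * Real.exp ((1 + |2 * ν|) * t) := by
          gcongr
          exact abs_sinh_mul_cosh_le ν ht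
      _ ≤ 2 * (C * Real.exp (-(x / 4 * Real.sinh t))) * Real.exp ((1 + |2 * ν|) * t) := by
          gcongr
      _ = _ := by ring
  · filter_upwards [ae_restrict_mem measurableSet_Ioi] with t (ht : 0 < t) y hy
    rw [Metric.mem_ball, Real.dist_eq, abs_lt] at hy
    have hy0 : 0 < y := by linarith [hy.1]
    have hs := Real.sinh_pos_iff.2 ht
    have hq : HasDerivAt (fun y => (y * Real.sinh t) ^ 2) (2 * (y * Real.sinh t) * Real.sinh t) y :=
      by simpa using ((hasDerivAt_id y).mul_const (Real.sinh t)).fun_pow 2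
    refine (((hasDerivAt_k1 (q := (y * Real.sinh t) ^ 2) (by positivity)).comp y hq).mul_const
      _).congr_deriv ?_
    ring

/-- An integration by parts in the variable of Nicholson's integral, which trades the order `ν`
for a derivative of the Macdonald function. -/
theorem mul_modDeriv_eq (ν : ℝ) {x : ℝ} (hx : 0 < x) :
    ν * modDeriv ν x = 4 / π ^ 2 * (x ^ 2 * ∫ t in Ioi (0 : ℝ),
      k0 ((x * Real.sinh t) ^ 2) * Real.sinh t * (Real.cosh t * Real.sinh (2 * ν * t))) := by
  have hu : ∀ t ∈ Ioi (0 : ℝ), HasDerivAt (fun t => k1 ((x * Real.sinh t) ^ 2))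
      (-k0 ((x * Real.sinh t) ^ 2) * (2 * (x * Real.sinh t) * (x * Real.cosh t))) t := by
    intro t (ht : 0 < t)
    have hs := Real.sinh_pos_iff.2 ht
    have hq : HasDerivAt (fun t => (x * Real.sinh t) ^ 2)
        (2 * (x * Real.sinh t) * (x * Real.cosh t)) t := by
      simpa using ((Real.hasDerivAt_sinh t).const_mul x).fun_pow 2
    exact (hasDerivAt_k1 (q := (x * Real.sinh t) ^ 2) (by positivity)).comp t hq
  have hv : ∀ t ∈ Ioi (0 : ℝ), HasDerivAt (fun t => Real.sinh (2 * ν * t))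
      (Real.cosh (2 * ν * t) * (2 * ν)) t := fun t _ => by
    simpa using ((hasDerivAt_id t).const_mul (2 * ν)).sinh
  have i1 := (integrableOn_k0_mul_sinh_mul hx (f := fun t => Real.cosh t * Real.sinh (2 * ν * t))
    (by fun_prop) fun t ht => abs_cosh_mul_sinh_le ν ht).const_mul (2 * x ^ 2)
  have i2 := (integrableOn_modDeriv hx ν).const_mul (2 * ν)
  have h := integral_Ioi_deriv_mul_eq_sub (a := 0) (a' := 0) (b' := 0) hu hv ?_ ?_ ?_
  · have e : ∀ t : ℝ, -k0 ((x * Real.sinh t) ^ 2) * (2 * (x * Real.sinh t) * (x * Real.cosh t)) *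
        Real.sinh (2 * ν * t) + k1 ((x * Real.sinh t) ^ 2) * (Real.cosh (2 * ν * t) * (2 * ν)) =
        2 * ν * (k1 ((x * Real.sinh t) ^ 2) * Real.cosh (2 * ν * t)) - 2 * x ^ 2 *
        (k0 ((x * Real.sinh t) ^ 2) * Real.sinh t * (Real.cosh t * Real.sinh (2 * ν * t))) :=
      fun t => by ring
    simp only [e] at h
    rw [integral_sub i2 i1, integral_const_mul, integral_const_mul] at h
    rw [modDeriv]
    linear_combination 4 / π ^ 2 / 2 * h
  · refine (i2.sub i1).congr (Eventually.of_forall fun t => ?_)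
    simp only [Pi.add_apply, Pi.mul_apply, Pi.sub_apply]
    ring
  · refine squeeze_zero_norm (a := fun t => 2 * |Real.sinh (2 * ν * t)|) (fun t => ?_) ?_
    · have hk := k1_pos (q := (x * Real.sinh t) ^ 2) (by positivity)
      have h1 := k1_sq_le |x * Real.sinh t|
      rw [sq_abs] at h1
      have h2 : Real.exp (-|x * Real.sinh t|) ≤ 1 := Real.exp_le_one_iff.2 (neg_nonpos.2 (abs_nonneg _))
      simp only [Pi.mul_apply]
      rw [norm_mul, Real.norm_of_nonneg hk.le, Real.norm_eq_abs]
      gcongr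
      linarith
    · have : Continuous fun t : ℝ => 2 * |Real.sinh (2 * ν * t)| := by fun_prop
      have h := this.tendsto 0
      norm_num at h
      exact h.mono_left nhdsWithin_le_nhds
  · refine squeeze_zero_norm' (a := fun t => 2 * (Real.exp ((1 + |2 * ν| + 1) ^ 2 / x) *
      Real.exp (-t))) ?_ ?_
    · filter_upwards [eventually_gt_atTop 0] with t ht
      have hk := k1_pos (q := (x * Real.sinh t) ^ 2) (by positivity)
      have h1 : |Real.sinh (2 * ν * t)| ≤ Real.exp ((1 + |2 * ν|) * t) := by
        refine le_trans ?_ (abs_cosh_mul_sinh_le ν ht)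
        rw [abs_mul, abs_of_pos (Real.cosh_pos t)]
        exact le_mul_of_one_le_left (abs_nonneg _) (Real.one_le_cosh t)
      simp only [Pi.mul_apply]
      rw [norm_mul, Real.norm_of_nonneg hk.le, Real.norm_eq_abs]
      calc _ ≤ 2 * Real.exp (-(x * Real.sinh t)) * Real.exp ((1 + |2 * ν|) * t) := by
            gcongr; exact k1_sq_le _
        _ = 2 * (Real.exp ((1 + |2 * ν|) * t) * Real.exp (-(x * Real.sinh t))) := by ring
        _ ≤ _ := mul_le_mul_of_nonneg_left (exp_mul_exp_neg_sinh_le hx _ ht.le) zero_le_two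
    · simpa using (Real.tendsto_exp_neg_atTop_nhds_zero.const_mul _).const_mul 2

theorem modSq_add_one_sub (ν : ℝ) {x : ℝ} (hx : 0 < x) :
    modSq (ν + 1) x - modSq ν x = 4 / π ^ 2 * (2 *
      ((∫ t in Ioi (0 : ℝ),
        k0 ((x * Real.sinh t) ^ 2) * Real.sinh t * (Real.sinh t * Real.cosh (2 * ν * t))) +
      ∫ t in Ioi (0 : ℝ),
        k0 ((x * Real.sinh t) ^ 2) * Real.sinh t * (Real.cosh t * Real.sinh (2 * ν * t)))) := by
  rw [modSq, modSq, ← mul_sub, ← integral_sub (integrableOn_modSq hx _) (integrableOn_modSq hx _),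
    ← integral_add, ← integral_const_mul (2 : ℝ)]
  · congr 1
    refine integral_congr_ae (Eventually.of_forall fun t => ?_)
    simp only
    have h1 : Real.cosh (2 * (ν + 1) * t) =
        Real.cosh (2 * ν * t) * (Real.cosh t ^ 2 + Real.sinh t ^ 2) +
        Real.sinh (2 * ν * t) * (2 * Real.sinh t * Real.cosh t) := by
      rw [show 2 * (ν + 1) * t = 2 * ν * t + 2 * t by ring, Real.cosh_add, Real.cosh_two_mul,
        Real.sinh_two_mul]
    rw [h1]
    linear_combination (k0 ((x * Real.sinh t) ^ 2) * Real.cosh (2 * ν * t)) * Real.cosh_sq t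
  · exact integrableOn_k0_mul_sinh_mul hx (by fun_prop) fun t ht => abs_sinh_mul_cosh_le ν ht
  · exact integrableOn_k0_mul_sinh_mul hx (by fun_prop) fun t ht => abs_cosh_mul_sinh_le ν ht

theorem hasDerivAt_mul_modCross (ν : ℝ) {x : ℝ} (hx : 0 < x) :
    HasDerivAt (fun x => ν * modSq ν x + modDeriv ν x) (x * (modSq ν x - modSq (ν + 1) x)) x := by
  refine (((hasDerivAt_modSq ν hx).const_mul ν).add (hasDerivAt_modDeriv ν hx)).congr_deriv ?_
  have h1 := modSq_add_one_sub ν hx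
  have h2 := mul_modDeriv_eq ν hx
  have h3 : ν * -(2 * modDeriv ν x / x) = -2 / x * (ν * modDeriv ν x) := by ring
  rw [h3, h2, ← neg_sub (modSq (ν + 1) x), h1]
  field_simp
  ring

theorem hasDerivAt_modCross (ν : ℝ) {x : ℝ} (hx : 0 < x) :
    HasDerivAt (modCross ν) (modSq ν x - modSq (ν + 1) x - modCross ν x / x) x := by
  refine ((hasDerivAt_mul_modCross ν hx).div (hasDerivAt_id x) hx.ne').congr_deriv ?_
  simp only [modCross, id]
  field_simp

theorem hasDerivAt_modSq' (ν : ℝ) {x : ℝ} (hx : 0 < x) :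
    HasDerivAt (modSq ν) (2 * ν / x * modSq ν x - 2 * modCross ν x) x := by
  refine (hasDerivAt_modSq ν hx).congr_deriv ?_
  simp only [modCross]
  ring

/-! ### Limits of Nicholson's integrals at infinity and at zero -/

theorem sqrt_four_mul_sq_add {x : ℝ} (hx : 0 < x) (y : ℝ) :
    √(4 * x ^ 2 + y ^ 2) = 2 * x * √(1 + (y / (2 * x)) ^ 2) := by
  rw [← Real.sqrt_sq (show 0 ≤ 2 * x by positivity), ← Real.sqrt_mul (by positivity),
    Real.sqrt_sq (show 0 ≤ 2 * x by positivity)]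
  congr 1
  field_simp
  ring

/-- Nicholson's integral after the substitution `y = 2 x sinh t`, which removes `x` from the
argument of the Macdonald function. -/
theorem modSq_eq_integral (s : ℝ) {x : ℝ} (hx : 0 < x) :
    modSq s x = 4 / π ^ 2 * ∫ y in Ioi (0 : ℝ), k0 (y ^ 2 / 4) *
      (Real.cosh (2 * s * Real.arsinh (y / (2 * x))) / √(4 * x ^ 2 + y ^ 2)) := by
  have himage : (fun y => Real.arsinh (y / (2 * x))) '' Ioi 0 = Ioi 0 := by
    ext t
    simp only [mem_image, mem_Ioi]
    constructor
    · rintro ⟨y, hy, rfl⟩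
      exact Real.arsinh_pos_iff.2 (by positivity)
    · intro ht
      refine ⟨2 * x * Real.sinh t, ?_, ?_⟩
      · have := Real.sinh_pos_iff.2 ht
        positivity
      · rw [mul_div_cancel_left₀ _ (by positivity), Real.arsinh_sinh]
  have hderiv : ∀ y ∈ Ioi (0 : ℝ), HasDerivWithinAt (fun y => Real.arsinh (y / (2 * x)))
      (√(4 * x ^ 2 + y ^ 2))⁻¹ (Ioi 0) y := by
    intro y _
    have h := ((hasDerivAt_id y).div_const (2 * x)).arsinh
    refine (h.congr_deriv ?_).hasDerivWithinAt
    have e := sqrt_four_mul_sq_add hx y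
    simp only [id, smul_eq_mul]
    rw [e, mul_inv]
    ring
  have hinj : InjOn (fun y => Real.arsinh (y / (2 * x))) (Ioi 0) := by
    intro a _ b _ h
    have := Real.arsinh_injective h
    rwa [div_left_inj' (by positivity)] at this
  rw [modSq]
  conv_lhs => rw [← himage]
  rw [integral_image_eq_integral_abs_deriv_smul measurableSet_Ioi hderiv hinj]
  congr 1
  refine setIntegral_congr_fun measurableSet_Ioi fun y (hy : 0 < y) => ?_
  simp only [smul_eq_mul, Real.sinh_arsinh]
  rw [abs_of_nonneg (by positivity), show (x * (y / (2 * x))) ^ 2 = y ^ 2 / 4 by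
    field_simp; norm_num]
  ring

theorem integrableOn_k0_mul_add_one_rpow {r : ℝ} (hr : 0 ≤ r) :
    IntegrableOn (fun y => k0 (y ^ 2 / 4) * (y + 1) ^ r) (Ioi 0) := by
  have h1 := (mellin_k0 (s := 1 / 2) (by norm_num)).1
  have h2 := (mellin_k0 (s := (r + 1) / 2) (by linarith)).1
  have hm : AEStronglyMeasurable (fun y => k0 (y ^ 2 / 4)) (volume.restrict (Ioi 0)) := by
    refine ContinuousOn.aestronglyMeasurable (continuousOn_k0.comp (by fun_prop) ?_)
      measurableSet_Ioi
    intro y (hy : 0 < y)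
    simp only [mem_Ioi]
    positivity
  refine ((h1.add h2).const_mul (2 ^ r)).mono' (hm.mul
    (Measurable.aestronglyMeasurable (by fun_prop))) ?_
  filter_upwards [ae_restrict_mem measurableSet_Ioi] with y (hy : 0 < y)
  have hk := k0_pos (q := y ^ 2 / 4) (by positivity)
  rw [Real.norm_of_nonneg (by positivity)]
  have h3 : (y + 1) ^ r ≤ 2 ^ r * (1 + y ^ r) := by
    rcases le_total y 1 with h | h
    · calc (y + 1) ^ r ≤ 2 ^ r := by gcongr; linarith
        _ ≤ _ := le_mul_of_one_le_right (by positivity) (by linarith [Real.rpow_nonneg hy.le r])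
    · calc (y + 1) ^ r ≤ (2 * y) ^ r := by gcongr; linarith
        _ = 2 ^ r * y ^ r := Real.mul_rpow (by norm_num) hy.le
        _ ≤ _ := by gcongr; linarith
  calc _ ≤ k0 (y ^ 2 / 4) * (2 ^ r * (1 + y ^ r)) := by gcongr
    _ = _ := by
      simp only [Pi.add_apply]
      rw [show 2 * (1 / 2 : ℝ) - 1 = 0 by norm_num, Real.rpow_zero,
        show 2 * ((r + 1) / 2) - 1 = r by ring]
      ring

theorem aestronglyMeasurable_modSq_integrand (s : ℝ) {x : ℝ} (hx : 0 < x) :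
    AEStronglyMeasurable (fun y => k0 (y ^ 2 / 4) *
      (Real.cosh (2 * s * Real.arsinh (y / (2 * x))) / √(4 * x ^ 2 + y ^ 2)))
      (volume.restrict (Ioi 0)) := by
  refine ContinuousOn.aestronglyMeasurable ?_ measurableSet_Ioi
  refine (continuousOn_k0.comp (by fun_prop) ?_).mul (ContinuousOn.div ?_ ?_ ?_)
  · intro y (hy : 0 < y)
    simp only [mem_Ioi]
    positivity
  · have : Continuous fun y => Real.cosh (2 * s * Real.arsinh (y / (2 * x))) :=
      Real.continuous_cosh.comp (continuous_const.mul (Real.continuous_arsinh.comp (by fun_prop)))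
    exact this.continuousOn
  · fun_prop
  · intro y _
    positivity

theorem cosh_mul_arsinh_le {s x y : ℝ} (hx : 0 < x) (hy : 0 < y) :
    Real.cosh (2 * s * Real.arsinh (y / (2 * x))) ≤
      ((y + √(4 * x ^ 2 + y ^ 2)) / (2 * x)) ^ |2 * s| := by
  have ha : 0 < Real.arsinh (y / (2 * x)) := Real.arsinh_pos_iff.2 (by positivity)
  refine (cosh_le_exp_abs_mul s ha.le).trans_eq ?_
  rw [mul_comm, Real.exp_mul, Real.exp_arsinh]
  congr 1
  have e := sqrt_four_mul_sq_add hx y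
  rw [e]
  field_simp

theorem sqrt_add_sq_le {x y : ℝ} (hx : 0 ≤ x) (hy : 0 ≤ y) :
    √(4 * x ^ 2 + y ^ 2) ≤ y + 2 * x := by
  rw [Real.sqrt_le_left (by positivity)]
  nlinarith [mul_nonneg hx hy]

theorem tendsto_mul_modSq_atTop (s : ℝ) :
    Tendsto (fun x => x * modSq s x) atTop (𝓝 (2 / π)) := by
  have hlim : Tendsto (fun x => ∫ y in Ioi (0 : ℝ), x * (k0 (y ^ 2 / 4) *
      (Real.cosh (2 * s * Real.arsinh (y / (2 * x))) / √(4 * x ^ 2 + y ^ 2)))) atTop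
      (𝓝 (∫ y in Ioi (0 : ℝ), k0 (y ^ 2 / 4) * (1 / 2))) := by
    refine tendsto_integral_filter_of_dominated_convergence
      (fun y => k0 (y ^ 2 / 4) * (y + 1) ^ |2 * s|) ?_ ?_
      (integrableOn_k0_mul_add_one_rpow (abs_nonneg _)) ?_
    · filter_upwards [eventually_gt_atTop 0] with x hx
        using (aestronglyMeasurable_modSq_integrand s hx).const_mul x
    · filter_upwards [eventually_ge_atTop 1] with x hx
      have hx0 : 0 < x := by linarith
      filter_upwards [ae_restrict_mem measurableSet_Ioi] with y (hy : 0 < y)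
      have hk := k0_pos (q := y ^ 2 / 4) (by positivity)
      have hc := Real.cosh_pos (2 * s * Real.arsinh (y / (2 * x)))
      rw [Real.norm_of_nonneg (by positivity)]
      have h1 : x ≤ √(4 * x ^ 2 + y ^ 2) := Real.le_sqrt_of_sq_le (by nlinarith)
      have h2 : (y + √(4 * x ^ 2 + y ^ 2)) / (2 * x) ≤ y + 1 := by
        rw [div_le_iff₀ (by positivity)]
        nlinarith [sqrt_add_sq_le hx0.le hy.le]
      calc _ = k0 (y ^ 2 / 4) * (Real.cosh (2 * s * Real.arsinh (y / (2 * x))) *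
            (x / √(4 * x ^ 2 + y ^ 2))) := by ring
        _ ≤ k0 (y ^ 2 / 4) * (Real.cosh (2 * s * Real.arsinh (y / (2 * x))) * 1) := by
            gcongr
            exact div_le_one_of_le₀ h1 (by positivity)
        _ ≤ k0 (y ^ 2 / 4) * (((y + √(4 * x ^ 2 + y ^ 2)) / (2 * x)) ^ |2 * s|) := by
            rw [mul_one]; gcongr; exact cosh_mul_arsinh_le hx0 hy
        _ ≤ _ := by gcongr
    · filter_upwards with y
      have hz : Tendsto (fun x : ℝ => y / (2 * x)) atTop (𝓝 0) :=
        tendsto_const_nhds.div_atTop (tendsto_id.const_mul_atTop (by norm_num))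
      have h1 : Tendsto (fun x : ℝ => Real.cosh (2 * s * Real.arsinh (y / (2 * x)))) atTop
          (𝓝 1) := by
        have hc : Continuous fun z => Real.cosh (2 * s * Real.arsinh z) :=
          Real.continuous_cosh.comp (continuous_const.mul Real.continuous_arsinh)
        have := (hc.tendsto 0).comp hz
        simpa [Function.comp_def] using this
      have h2 : Tendsto (fun x : ℝ => √(1 + (y / (2 * x)) ^ 2)) atTop (𝓝 1) := by
        have hc : Continuous fun z : ℝ => √(1 + z ^ 2) := by fun_prop
        have := (hc.tendsto 0).comp hz
        simpa [Function.comp_def] using this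
      have h3 := (h1.div h2 one_ne_zero).const_mul (k0 (y ^ 2 / 4) * (1 / 2))
      rw [div_one, mul_one] at h3
      refine h3.congr' ?_
      filter_upwards [eventually_gt_atTop 0] with x hx
      have e := sqrt_four_mul_sq_add hx y
      simp only [Pi.div_apply]
      rw [e]
      field_simp
  have hval : ∫ y in Ioi (0 : ℝ), k0 (y ^ 2 / 4) * (1 / 2) = π / 2 := by
    have h := (mellin_k0 (s := 1 / 2) (by norm_num)).2
    rw [Real.Gamma_one_half_eq, Real.sq_sqrt Real.pi_pos.le,
      show 2 * (1 / 2 : ℝ) - 1 = 0 by norm_num, ← Real.sqrt_eq_rpow,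
      show (4 : ℝ) = 2 ^ 2 by norm_num, Real.sqrt_sq (by norm_num)] at h
    simp only [Real.rpow_zero, mul_one] at h
    rw [integral_mul_const, show (2 : ℝ) ^ 2 = 4 by norm_num] at *
    rw [h]
    ring
  rw [hval] at hlim
  have h := hlim.const_mul (4 / π ^ 2)
  rw [show 4 / π ^ 2 * (π / 2) = 2 / π by field_simp; norm_num] at h
  refine h.congr' ?_
  filter_upwards [eventually_gt_atTop 0] with x hx
  rw [integral_const_mul, modSq_eq_integral s hx]
  ring

theorem tendsto_rpow_mul_modSq_zero {s : ℝ} (hs : 0 < s) :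
    Tendsto (fun x => x ^ (2 * s) * modSq s x) (𝓝[>] 0) (𝓝 (4 ^ s * Real.Gamma s ^ 2 / π ^ 2)) := by
  have habs : |2 * s| = 2 * s := abs_of_pos (by positivity)
  have hlim : Tendsto (fun x => ∫ y in Ioi (0 : ℝ), x ^ (2 * s) * (k0 (y ^ 2 / 4) *
      (Real.cosh (2 * s * Real.arsinh (y / (2 * x))) / √(4 * x ^ 2 + y ^ 2)))) (𝓝[>] 0)
      (𝓝 (∫ y in Ioi (0 : ℝ), k0 (y ^ 2 / 4) * y ^ (2 * s - 1) * (1 / 2))) := by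
    refine tendsto_integral_filter_of_dominated_convergence
      (fun y => k0 (y ^ 2 / 4) * y ^ (2 * s - 1) + k0 (y ^ 2 / 4) * (y + 1) ^ (2 * s)) ?_ ?_
      ((mellin_k0 hs).1.add (integrableOn_k0_mul_add_one_rpow (by positivity))) ?_
    · filter_upwards [self_mem_nhdsWithin] with x hx
        using (aestronglyMeasurable_modSq_integrand s hx).const_mul _
    · filter_upwards [Ioo_mem_nhdsGT (show (0 : ℝ) < 1 / 2 by norm_num)] with x hx
      have hx0 : 0 < x := hx.1
      have hx1 := hx.2
      filter_upwards [ae_restrict_mem measurableSet_Ioi] with y (hy : 0 < y)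
      have hk := k0_pos (q := y ^ 2 / 4) (by positivity)
      have hc := Real.cosh_pos (2 * s * Real.arsinh (y / (2 * x)))
      rw [Real.norm_of_nonneg (by positivity), ← mul_add]
      set S := √(4 * x ^ 2 + y ^ 2) with hS
      have hyS : y ≤ S := Real.le_sqrt_of_sq_le (by nlinarith)
      have hS0 : 0 < S := hy.trans_le hyS
      have hS1 : S ≤ y + 1 := (sqrt_add_sq_le hx0.le hy.le).trans (by linarith)
      have h1 : x ^ (2 * s) * Real.cosh (2 * s * Real.arsinh (y / (2 * x))) ≤ S ^ (2 * s) := by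
        calc _ ≤ x ^ (2 * s) * ((y + S) / (2 * x)) ^ (2 * s) := by
              gcongr
              exact (cosh_mul_arsinh_le hx0 hy).trans_eq (by rw [habs])
          _ = ((y + S) / 2) ^ (2 * s) := by
              rw [← Real.mul_rpow hx0.le (by positivity)]
              congr 1
              field_simp
          _ ≤ _ := by gcongr; linarith
      have h2 : S ^ (2 * s) / S ≤ y ^ (2 * s - 1) + (y + 1) ^ (2 * s) := by
        rw [← Real.rpow_sub_one hS0.ne']
        rcases le_total (2 * s - 1) 0 with h | h
        · have := Real.rpow_le_rpow_of_nonpos hy hyS h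
          have := Real.rpow_nonneg (show 0 ≤ y + 1 by linarith) (2 * s)
          linarith
        · have h3 : S ^ (2 * s - 1) ≤ (y + 1) ^ (2 * s - 1) := by gcongr
          have h4 : (y + 1) ^ (2 * s - 1) ≤ (y + 1) ^ (2 * s) :=
            Real.rpow_le_rpow_of_exponent_le (by linarith) (by linarith)
          have := Real.rpow_nonneg hy.le (2 * s - 1)
          linarith
      calc _ = k0 (y ^ 2 / 4) *
            (x ^ (2 * s) * Real.cosh (2 * s * Real.arsinh (y / (2 * x))) / S) := by ring
        _ ≤ k0 (y ^ 2 / 4) * (S ^ (2 * s) / S) := by gcongr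
        _ ≤ _ := by gcongr
    · filter_upwards [ae_restrict_mem measurableSet_Ioi] with y (hy : 0 < y)
      have hA : Tendsto (fun x : ℝ => (y + √(4 * x ^ 2 + y ^ 2)) / 2) (𝓝[>] 0) (𝓝 y) := by
        have hc : Continuous fun x : ℝ => (y + √(4 * x ^ 2 + y ^ 2)) / 2 := by fun_prop
        have h := hc.tendsto 0
        norm_num [Real.sqrt_sq hy.le] at h
        exact h.mono_left nhdsWithin_le_nhds
      have hS : Tendsto (fun x : ℝ => √(4 * x ^ 2 + y ^ 2)) (𝓝[>] 0) (𝓝 y) := by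
        have hc : Continuous fun x : ℝ => √(4 * x ^ 2 + y ^ 2) := by fun_prop
        have h := hc.tendsto 0
        norm_num [Real.sqrt_sq hy.le] at h
        exact h.mono_left nhdsWithin_le_nhds
      have hX : Tendsto (fun x : ℝ => x ^ (4 * s)) (𝓝[>] 0) (𝓝 0) := by
        have h := (Real.continuous_rpow_const (show 0 ≤ 4 * s by positivity)).tendsto 0
        rw [Real.zero_rpow (by positivity)] at h
        exact h.mono_left nhdsWithin_le_nhds
      have hA1 := hA.rpow_const (p := 2 * s) (Or.inl hy.ne')
      have hA2 := hA.rpow_const (p := -(2 * s)) (Or.inl hy.ne')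
      have h := (((hA1.add (hX.mul hA2)).div hS hy.ne').mul_const (1 / 2)).const_mul
        (k0 (y ^ 2 / 4))
      rw [zero_mul, add_zero, ← Real.rpow_sub_one hy.ne', ← mul_assoc] at h
      refine h.congr' ?_
      filter_upwards [self_mem_nhdsWithin] with x (hx : 0 < x)
      have e : Real.exp (Real.arsinh (y / (2 * x))) = (y + √(4 * x ^ 2 + y ^ 2)) / 2 / x := by
        have e := sqrt_four_mul_sq_add hx y
        rw [Real.exp_arsinh, e]
        field_simp
      simp only [Pi.div_apply]
      rw [cosh_eq_exp_add, mul_comm (2 * s), Real.exp_mul, mul_comm (-(2 * s)), Real.exp_mul, e,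
        Real.div_rpow (by positivity) hx.le, Real.div_rpow (by positivity) hx.le,
        Real.rpow_neg hx.le, show 4 * s = 2 * s + 2 * s by ring, Real.rpow_add hx]
      field_simp
  rw [integral_mul_const, (mellin_k0 hs).2] at hlim
  have h := hlim.const_mul (4 / π ^ 2)
  rw [show 4 / π ^ 2 * (4 ^ s * Real.Gamma s ^ 2 / 2 * (1 / 2)) =
    4 ^ s * Real.Gamma s ^ 2 / π ^ 2 by ring] at h
  refine h.congr' ?_
  filter_upwards [self_mem_nhdsWithin] with x hx
  rw [integral_const_mul, modSq_eq_integral s hx]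
  ring

theorem tendsto_modDeriv_atTop (ν : ℝ) : Tendsto (modDeriv ν) atTop (𝓝 0) := by
  have hlim : Tendsto (fun x => ∫ t in Ioi (0 : ℝ), k1 ((x * Real.sinh t) ^ 2) *
      Real.cosh (2 * ν * t)) atTop (𝓝 (∫ _ in Ioi (0 : ℝ), (0 : ℝ))) := by
    refine tendsto_integral_filter_of_dominated_convergence
      (fun t => 2 * (Real.exp (|2 * ν| * t) * Real.exp (-(1 * Real.sinh t)))) ?_ ?_
      ((integrableOn_exp_mul_exp_neg_sinh one_pos _).const_mul 2) ?_
    · filter_upwards [eventually_gt_atTop 0] with x hx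
        using (integrableOn_modDeriv hx ν).aestronglyMeasurable
    · filter_upwards [eventually_ge_atTop 1] with x hx
      filter_upwards [ae_restrict_mem measurableSet_Ioi] with t (ht : 0 < t)
      have hs := Real.sinh_pos_iff.2 ht
      have hk := k1_pos (q := (x * Real.sinh t) ^ 2) (by positivity)
      have hc := Real.cosh_pos (2 * ν * t)
      rw [Real.norm_of_nonneg (by positivity)]
      calc _ ≤ 2 * Real.exp (-(x * Real.sinh t)) * Real.exp (|2 * ν| * t) := by
            gcongr
            · exact k1_sq_le _
            · exact cosh_le_exp_abs_mul ν ht.le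
        _ ≤ 2 * Real.exp (-(1 * Real.sinh t)) * Real.exp (|2 * ν| * t) := by gcongr
        _ = _ := by ring
    · filter_upwards [ae_restrict_mem measurableSet_Ioi] with t (ht : 0 < t)
      have hs := Real.sinh_pos_iff.2 ht
      have h1 : Tendsto (fun x => 2 * Real.exp (-(x * Real.sinh t))) atTop (𝓝 0) := by
        simpa using (Real.tendsto_exp_neg_atTop_nhds_zero.comp
          (tendsto_id.atTop_mul_const hs)).const_mul 2
      have h2 : Tendsto (fun x => k1 ((x * Real.sinh t) ^ 2)) atTop (𝓝 0) :=
        squeeze_zero (fun x => (k1_pos (by positivity)).le) (fun x => k1_sq_le _) h1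
      simpa using h2.mul_const (Real.cosh (2 * ν * t))
  have h := hlim.const_mul (4 / π ^ 2)
  rw [integral_zero, mul_zero] at h
  exact h

theorem tendsto_modSq_atTop (ν : ℝ) : Tendsto (modSq ν) atTop (𝓝 0) := by
  have h := (tendsto_mul_modSq_atTop ν).mul tendsto_inv_atTop_zero
  rw [mul_zero] at h
  refine h.congr' ?_
  filter_upwards [eventually_gt_atTop 0] with x hx
  field_simp

theorem tendsto_mul_modCross_aux (ν : ℝ) :
    Tendsto (fun x => ν * modSq ν x + modDeriv ν x) atTop (𝓝 0) := by
  simpa using ((tendsto_modSq_atTop ν).const_mul ν).add (tendsto_modDeriv_atTop ν)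

theorem mul_modCross (ν : ℝ) {x : ℝ} (hx : 0 < x) :
    x * modCross ν x = ν * modSq ν x + modDeriv ν x := by
  rw [modCross, mul_div_cancel₀ _ hx.ne']

theorem tendsto_mul_modCross_atTop (ν : ℝ) :
    Tendsto (fun x => x * modCross ν x) atTop (𝓝 0) := by
  refine (tendsto_mul_modCross_aux ν).congr' ?_
  filter_upwards [eventually_gt_atTop 0] with x hx using (mul_modCross ν hx).symm

theorem modCross_neg_sub_one (ν : ℝ) {x : ℝ} (hx : 0 < x) :
    modCross (-ν - 1) x = -modCross ν x := by
  have h : (ν * modSq ν x + modDeriv ν x) +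
      ((-ν - 1) * modSq (-ν - 1) x + modDeriv (-ν - 1) x) = 0 := by
    refine eq_of_hasDerivAt_zero (l := atTop) (f := fun x => (ν * modSq ν x + modDeriv ν x) +
      ((-ν - 1) * modSq (-ν - 1) x + modDeriv (-ν - 1) x)) (fun y hy => ?_)
      (eventually_gt_atTop 0) ?_ hx
    · refine ((hasDerivAt_mul_modCross ν hy).add
        (hasDerivAt_mul_modCross (-ν - 1) hy)).congr_deriv ?_
      rw [sub_add_cancel, modSq_neg, show -ν - 1 = -(ν + 1) by ring, modSq_neg]
      ring
    · simpa using (tendsto_mul_modCross_aux ν).add (tendsto_mul_modCross_aux (-ν - 1))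
  rw [modCross, modCross, ← neg_div]
  congr 1
  linarith

theorem hasDerivAt_modSq_add_one (ν : ℝ) {x : ℝ} (hx : 0 < x) :
    HasDerivAt (modSq (ν + 1)) (2 * modCross ν x - 2 * (ν + 1) / x * modSq (ν + 1) x) x := by
  have h := hasDerivAt_modSq' (-ν - 1) hx
  rw [modCross_neg_sub_one ν hx, show -ν - 1 = -(ν + 1) by ring, modSq_neg] at h
  have e : modSq (-(ν + 1)) = modSq (ν + 1) := funext fun y => modSq_neg _ _
  rw [e] at h
  refine h.congr_deriv ?_
  ring

/-- The determinant of the quadratic form attached to Nicholson's integrals is conserved by the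
differential system, and is therefore given by the limits at infinity. -/
theorem modSq_mul_modSq_sub (ν : ℝ) {x : ℝ} (hx : 0 < x) :
    x ^ 2 * (modSq ν x * modSq (ν + 1) x - modCross ν x ^ 2) = 4 / π ^ 2 := by
  refine eq_of_hasDerivAt_zero (l := atTop) (f := fun x => x ^ 2 *
    (modSq ν x * modSq (ν + 1) x - modCross ν x ^ 2)) (fun y hy => ?_)
    (eventually_gt_atTop 0) ?_ hx
  · have h1 := hasDerivAt_modSq' ν hy
    have h2 := hasDerivAt_modSq_add_one ν hy
    have h3 := hasDerivAt_modCross ν hy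
    refine ((hasDerivAt_pow 2 y).mul ((h1.mul h2).sub (h3.fun_pow 2))).congr_deriv ?_
    simp only [Pi.sub_apply, Pi.mul_apply]
    field_simp
    ring
  · have h := ((tendsto_mul_modSq_atTop ν).mul (tendsto_mul_modSq_atTop (ν + 1))).sub
      ((tendsto_mul_modCross_atTop ν).pow 2)
    rw [show 2 / π * (2 / π) - 0 ^ 2 = 4 / π ^ 2 by field_simp; norm_num] at h
    refine h.congr fun x => ?_
    ring

/-! ### Analyticity in the order -/

/-- The two-sided Laplace transform of a density on `(0, ∞)` that decays faster than any
exponential is real analytic, as a moment generating function. -/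
theorem analyticOnNhd_integral_mul_exp {g : ℝ → ℝ} (hg0 : ∀ t, 0 < t → 0 ≤ g t)
    (hgm : AEStronglyMeasurable g (volume.restrict (Ioi 0)))
    (hg : ∀ b : ℝ, IntegrableOn (fun t => g t * Real.exp (b * t)) (Ioi 0)) :
    AnalyticOnNhd ℝ (fun b => ∫ t in Ioi (0 : ℝ), g t * Real.exp (b * t)) univ := by
  set m := (volume.restrict (Ioi (0 : ℝ))).withDensity fun t => ENNReal.ofReal (g t) with hm
  have hmeas : AEMeasurable (fun t => ENNReal.ofReal (g t)) (volume.restrict (Ioi 0)) :=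
    hgm.aemeasurable.ennreal_ofReal
  have hfin : ∀ᵐ t ∂(volume.restrict (Ioi (0 : ℝ))), ENNReal.ofReal (g t) < ⊤ :=
    Eventually.of_forall fun _ => ENNReal.ofReal_lt_top
  have he : ∀ b : ℝ, (fun t => (ENNReal.ofReal (g t)).toReal • Real.exp (b * t))
      =ᵐ[volume.restrict (Ioi 0)] fun t => g t * Real.exp (b * t) := fun b => by
    filter_upwards [ae_restrict_mem measurableSet_Ioi] with t ht
    rw [ENNReal.toReal_ofReal (hg0 t ht), smul_eq_mul]
  have hset : ProbabilityTheory.integrableExpSet (fun t : ℝ => t) m = univ := by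
    refine eq_univ_of_forall fun b => ?_
    change Integrable (fun t => Real.exp (b * t)) m
    rw [hm, integrable_withDensity_iff_integrable_smul₀' hmeas hfin]
    exact (hg b).congr (he b).symm
  have h := ProbabilityTheory.analyticOnNhd_mgf (X := fun t : ℝ => t) (μ := m)
  rw [hset, interior_univ] at h
  have e : (fun b => ∫ t in Ioi (0 : ℝ), g t * Real.exp (b * t)) =
      ProbabilityTheory.mgf (fun t : ℝ => t) m := by
    funext b
    rw [ProbabilityTheory.mgf, hm, integral_withDensity_eq_integral_toReal_smul₀ hmeas hfin]
    exact (integral_congr_ae (he b)).symm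
  rw [e]
  exact h

theorem analyticOnNhd_integral_mul_cosh {g : ℝ → ℝ} (hg0 : ∀ t, 0 < t → 0 ≤ g t)
    (hgm : AEStronglyMeasurable g (volume.restrict (Ioi 0)))
    (hg : ∀ b : ℝ, IntegrableOn (fun t => g t * Real.exp (b * t)) (Ioi 0)) :
    AnalyticOnNhd ℝ (fun ν => 4 / π ^ 2 * ∫ t in Ioi (0 : ℝ), g t * Real.cosh (2 * ν * t))
      univ := by
  have h := analyticOnNhd_integral_mul_exp hg0 hgm hg
  have e : (fun ν => 4 / π ^ 2 * ∫ t in Ioi (0 : ℝ), g t * Real.cosh (2 * ν * t)) =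
      fun ν => 4 / π ^ 2 * (((∫ t in Ioi (0 : ℝ), g t * Real.exp ((2 * ν) * t)) +
        ∫ t in Ioi (0 : ℝ), g t * Real.exp (-(2 * ν) * t)) / 2) := by
    funext ν
    rw [← integral_add (hg _) (hg _), ← integral_div]
    congr 1
    refine integral_congr_ae (Eventually.of_forall fun t => ?_)
    simp only [cosh_eq_exp_add]
    ring
  rw [e]
  intro ν _
  have h1 := (h (2 * ν) (mem_univ _)).fun_comp (f := fun ν : ℝ => 2 * ν) (by fun_prop)
  have h2 := (h (-(2 * ν)) (mem_univ _)).fun_comp (f := fun ν : ℝ => -(2 * ν)) (by fun_prop)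
  exact analyticAt_const.mul ((h1.add h2).div_const)

theorem analyticAt_modSq (ν : ℝ) {x : ℝ} (hx : 0 < x) : AnalyticAt ℝ (fun ν => modSq ν x) ν :=
  analyticOnNhd_integral_mul_cosh (fun t ht => by
    have := Real.sinh_pos_iff.2 ht
    exact (k0_pos (by positivity)).le) (aestronglyMeasurable_k0_sinh hx)
    (integrableOn_k0_mul_exp hx) ν (mem_univ _)

theorem analyticAt_modDeriv (ν : ℝ) {x : ℝ} (hx : 0 < x) :
    AnalyticAt ℝ (fun ν => modDeriv ν x) ν :=
  analyticOnNhd_integral_mul_cosh (fun t _ => (k1_pos (by positivity)).le)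
    (aestronglyMeasurable_k1_sinh hx) (integrableOn_k1_mul_exp hx) ν (mem_univ _)

theorem analyticAt_modCross (ν : ℝ) {x : ℝ} (hx : 0 < x) :
    AnalyticAt ℝ (fun ν => modCross ν x) ν :=
  ((analyticAt_id.mul (analyticAt_modSq ν hx)).add (analyticAt_modDeriv ν hx)).div_const

theorem analyticAt_besselJ (ν : ℝ) {x : ℝ} (hx : 0 < x) :
    AnalyticAt ℝ (fun ν => besselJ ν x) ν := analyticOnNhd_besselJ hx ν (mem_univ _)

/-! ### The quadratic form of Nicholson's integrals on Bessel functions -/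

/-- The bilinear form attached to Nicholson's integrals, on two pairs of neighbouring Bessel
functions `(a, a')` and `(b, b')`, that is, solutions of the recurrences of `J_ν` and `J_{ν+1}`. On
such pairs it does not depend on `x`. -/
noncomputable def nicholsonForm (ν x a a' b b' : ℝ) : ℝ :=
  x ^ 2 * (modSq ν x * (a' * b') + modSq (ν + 1) x * (a * b) - modCross ν x * (a * b' + a' * b))

theorem hasDerivAt_nicholsonForm_besselJ (ν : ℝ) {x : ℝ} (hx : 0 < x) :
    HasDerivAt (fun x => nicholsonForm ν x (besselJ ν x) (besselJ (ν + 1) x) (besselJ ν x)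
      (besselJ (ν + 1) x)) 0 x := by
  have h1 := hasDerivAt_modSq' ν hx
  have h2 := hasDerivAt_modSq_add_one ν hx
  have h3 := hasDerivAt_modCross ν hx
  have h4 := hasDerivAt_besselJ ν hx
  have h5 := hasDerivAt_besselJ_add_one ν hx
  refine ((hasDerivAt_pow 2 x).mul (((h1.mul (h5.mul h5)).add (h2.mul (h4.mul h4))).sub
    (h3.mul ((h4.mul h5).add (h5.mul h4))))).congr_deriv ?_
  simp only [Pi.sub_apply, Pi.mul_apply, Pi.add_apply]
  field_simp
  ring

theorem nicholsonForm_besselJ_of_pos {ν : ℝ} (hν : 0 < ν) {x : ℝ} (hx : 0 < x) :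
    nicholsonForm ν x (besselJ ν x) (besselJ (ν + 1) x) (besselJ ν x) (besselJ (ν + 1) x) =
      4 / π ^ 2 := by
  refine eq_of_hasDerivAt_zero (l := 𝓝[>] (0 : ℝ)) (f := fun x => nicholsonForm ν x (besselJ ν x)
    (besselJ (ν + 1) x) (besselJ ν x) (besselJ (ν + 1) x))
    (fun y hy => hasDerivAt_nicholsonForm_besselJ ν hy) self_mem_nhdsWithin ?_ hx
  have hP : Tendsto (fun x => x ^ 2 * (modSq ν x * besselJ (ν + 1) x ^ 2)) (𝓝[>] 0) (𝓝 0) := by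
    have hx4 : Tendsto (fun x : ℝ => x ^ 4 / 2 ^ (2 * ν + 2)) (𝓝[>] 0) (𝓝 0) := by
      have : Continuous fun x : ℝ => x ^ 4 / 2 ^ (2 * ν + 2) := by fun_prop
      have h := this.tendsto 0
      norm_num at h
      exact h.mono_left nhdsWithin_le_nhds
    have h := ((tendsto_rpow_mul_modSq_zero hν).mul
      ((tendsto_entireJ_zero (ν + 1)).pow 2)).mul hx4
    rw [mul_zero] at h
    refine h.congr' ?_
    filter_upwards [self_mem_nhdsWithin] with y (hy : 0 < y)
    have hy2 : 0 < y / 2 := by positivity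
    rw [besselJ_eq _ hy, mul_pow, ← Real.rpow_natCast ((y / 2) ^ (ν + 1)), ← Real.rpow_mul hy2.le,
      show (ν + 1) * ((2 : ℕ) : ℝ) = 2 * ν + 2 by push_cast; ring, Real.div_rpow hy.le zero_le_two,
      Real.rpow_add hy, Real.rpow_two]
    ring
  have hQ : Tendsto (fun x => x ^ 2 * (modSq (ν + 1) x * besselJ ν x ^ 2)) (𝓝[>] 0)
      (𝓝 (4 / π ^ 2)) := by
    have h := ((tendsto_rpow_mul_modSq_zero (s := ν + 1) (by linarith)).mul
      ((tendsto_entireJ_zero ν).pow 2)).mul_const (2 ^ (2 * ν))⁻¹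
    have e : 4 ^ (ν + 1) * Real.Gamma (ν + 1) ^ 2 / π ^ 2 * (Real.Gamma (ν + 1))⁻¹ ^ 2 *
        (2 ^ (2 * ν))⁻¹ = 4 / π ^ 2 := by
      have hG : Real.Gamma (ν + 1) ≠ 0 := (Real.Gamma_pos_of_pos (by linarith)).ne'
      rw [Real.rpow_add_one (by norm_num), Real.rpow_mul zero_le_two, Real.rpow_two,
        show (2 : ℝ) ^ 2 = 4 by norm_num]
      field_simp
    rw [e] at h
    refine h.congr' ?_
    filter_upwards [self_mem_nhdsWithin] with y (hy : 0 < y)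
    have hy2 : 0 < y / 2 := by positivity
    rw [besselJ_eq _ hy, mul_pow, ← Real.rpow_natCast ((y / 2) ^ ν), ← Real.rpow_mul hy2.le,
      show ν * ((2 : ℕ) : ℝ) = 2 * ν by push_cast; ring, Real.div_rpow hy.le zero_le_two,
      show 2 * (ν + 1) = 2 * ν + 2 by ring, Real.rpow_add hy, Real.rpow_two]
    ring
  -- The mixed term is controlled by the other two, since the determinant of the form is positive.
  have hR : Tendsto (fun x => x ^ 2 * (modCross ν x * (besselJ ν x * besselJ (ν + 1) x)))
      (𝓝[>] 0) (𝓝 0) := by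
    have h2 : Tendsto (fun x => (x ^ 2 * (modCross ν x * (besselJ ν x * besselJ (ν + 1) x))) ^ 2)
        (𝓝[>] 0) (𝓝 0) := by
      have hPQ := hP.mul hQ
      rw [zero_mul] at hPQ
      refine squeeze_zero' (Eventually.of_forall fun y => sq_nonneg _) ?_ hPQ
      filter_upwards [self_mem_nhdsWithin] with y (hy : 0 < y)
      have hd := modSq_mul_modSq_sub ν hy
      have hpos : 0 ≤ y ^ 2 * (modSq ν y * modSq (ν + 1) y - modCross ν y ^ 2) := by
        rw [hd]; positivity
      have h3 : 0 ≤ (y * (besselJ ν y * besselJ (ν + 1) y)) ^ 2 := sq_nonneg _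
      nlinarith [mul_nonneg hpos h3]
    have h4 := h2.sqrt
    simp only [Real.sqrt_sq_eq_abs, Real.sqrt_zero] at h4
    exact (tendsto_zero_iff_abs_tendsto_zero _).2 h4
  have h := (hP.add hQ).sub (hR.const_mul 2)
  rw [zero_add, mul_zero, sub_zero] at h
  refine h.congr fun y => ?_
  rw [nicholsonForm]
  ring

theorem nicholsonForm_besselJ (ν : ℝ) {x : ℝ} (hx : 0 < x) :
    nicholsonForm ν x (besselJ ν x) (besselJ (ν + 1) x) (besselJ ν x) (besselJ (ν + 1) x) =
      4 / π ^ 2 := by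
  have ha : AnalyticOnNhd ℝ (fun ν => nicholsonForm ν x (besselJ ν x) (besselJ (ν + 1) x)
      (besselJ ν x) (besselJ (ν + 1) x)) univ := by
    intro ν _
    have h1 := analyticAt_modSq ν hx
    have h2 := (analyticAt_modSq (ν + 1) hx).fun_comp (f := fun ν : ℝ => ν + 1) (by fun_prop)
    have h3 := analyticAt_modCross ν hx
    have h4 := analyticAt_besselJ ν hx
    have h5 := (analyticAt_besselJ (ν + 1) hx).fun_comp (f := fun ν : ℝ => ν + 1) (by fun_prop)
    exact analyticAt_const.mul (((h1.mul (h5.mul h5)).add (h2.mul (h4.mul h4))).sub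
      (h3.mul ((h4.mul h5).add (h5.mul h4))))
  refine congrFun (ha.eq_of_eventuallyEq (g := fun _ => 4 / π ^ 2) analyticOnNhd_const
    (z₀ := 1) ?_) ν
  filter_upwards [lt_mem_nhds (zero_lt_one (α := ℝ))] with μ hμ
    using nicholsonForm_besselJ_of_pos hμ hx

/-- The value of the form on `J_{-ν}`, whose neighbour in the recurrences is `-J_{-ν-1}`, by
reflection of the order. -/
theorem nicholsonForm_besselJ_neg (ν : ℝ) {x : ℝ} (hx : 0 < x) :
    nicholsonForm ν x (besselJ (-ν) x) (-besselJ (-ν - 1) x) (besselJ (-ν) x)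
      (-besselJ (-ν - 1) x) = 4 / π ^ 2 := by
  rw [← nicholsonForm_besselJ (-ν - 1) hx, nicholsonForm, nicholsonForm,
    modCross_neg_sub_one ν hx, sub_add_cancel, modSq_neg, show -ν - 1 = -(ν + 1) by ring, modSq_neg]
  ring

/-- The value of the form on the pair `J_ν`, `J_{-ν}`. Its square is known from the determinant
and from the Wronskian of `J_ν` and `J_{-ν}`; the sign, which cannot change with the order, is that
at the order zero. -/
theorem nicholsonForm_besselJ_besselJ_neg (ν : ℝ) {x : ℝ} (hx : 0 < x) :
    nicholsonForm ν x (besselJ ν x) (besselJ (ν + 1) x) (besselJ (-ν) x)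
      (-besselJ (-ν - 1) x) = 4 / π ^ 2 * Real.cos (ν * π) := by
  set k : ℝ → ℝ := fun ν => nicholsonForm ν x (besselJ ν x) (besselJ (ν + 1) x) (besselJ (-ν) x)
      (-besselJ (-ν - 1) x) with hk
  have ha : AnalyticOnNhd ℝ k univ := by
    intro ν _
    have h1 := analyticAt_modSq ν hx
    have h2 := (analyticAt_modSq (ν + 1) hx).fun_comp (f := fun ν : ℝ => ν + 1) (by fun_prop)
    have h3 := analyticAt_modCross ν hx
    have h4 := analyticAt_besselJ ν hx
    have h5 := (analyticAt_besselJ (ν + 1) hx).fun_comp (f := fun ν : ℝ => ν + 1) (by fun_prop)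
    have h6 := (analyticAt_besselJ (-ν) hx).fun_comp (f := fun ν : ℝ => -ν) (by fun_prop)
    have h7 := ((analyticAt_besselJ (-ν - 1) hx).fun_comp (f := fun ν : ℝ => -ν - 1)
      (by fun_prop)).neg
    exact analyticAt_const.mul (((h1.mul (h5.mul h7)).add (h2.mul (h4.mul h6))).sub
      (h3.mul ((h4.mul h7).add (h5.mul h6))))
  have hsq : ∀ μ, (k μ - 4 / π ^ 2 * Real.cos (μ * π)) * (k μ + 4 / π ^ 2 * Real.cos (μ * π)) =
      0 := by
    intro μ
    have h1 := nicholsonForm_besselJ μ hx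
    have h2 := nicholsonForm_besselJ_neg μ hx
    have h3 := modSq_mul_modSq_sub μ hx
    have h4 := besselJ_cross μ hx
    have h5 := Real.sin_sq_add_cos_sq (μ * π)
    have hdet : nicholsonForm μ x (besselJ μ x) (besselJ (μ + 1) x) (besselJ μ x)
        (besselJ (μ + 1) x) * nicholsonForm μ x (besselJ (-μ) x) (-besselJ (-μ - 1) x)
        (besselJ (-μ) x) (-besselJ (-μ - 1) x) - k μ ^ 2 =
        x ^ 2 * (modSq μ x * modSq (μ + 1) x - modCross μ x ^ 2) *
        (x * (besselJ (μ + 1) x * besselJ (-μ) x + besselJ μ x * besselJ (-μ - 1) x)) ^ 2 := by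
      simp only [hk, nicholsonForm]
      ring
    rw [h1, h2, h3, h4] at hdet
    have : (4 / π ^ 2) ^ 2 - k μ ^ 2 = (4 / π ^ 2) ^ 2 * Real.sin (μ * π) ^ 2 := by
      rw [sq (4 / π ^ 2), hdet]
      ring
    linear_combination -this - (4 / π ^ 2) ^ 2 * h5
  have h0 : k 0 = 4 / π ^ 2 := by
    have hneg := besselJ_neg_nat x 1
    norm_num at hneg
    rw [← nicholsonForm_besselJ 0 hx]
    simp only [hk]
    rw [neg_zero, zero_sub, hneg, neg_neg, zero_add]
  have hev : ∀ᶠ μ in 𝓝 (0 : ℝ), k μ + 4 / π ^ 2 * Real.cos (μ * π) ≠ 0 := by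
    have hc : ContinuousAt (fun μ => k μ + 4 / π ^ 2 * Real.cos (μ * π)) 0 :=
      (ha 0 (mem_univ _)).continuousAt.add (Continuous.continuousAt (by fun_prop))
    refine hc.eventually_ne ?_
    rw [h0, zero_mul, Real.cos_zero]
    positivity
  refine congrFun (ha.eq_of_eventuallyEq (g := fun μ => 4 / π ^ 2 * Real.cos (μ * π))
    (fun μ _ => by fun_prop) (z₀ := 0) ?_) ν
  filter_upwards [hev] with μ hμ
  exact sub_eq_zero.1 ((mul_eq_zero.1 (hsq μ)).resolve_right hμ)

/-! ### The Bessel function of the second kind -/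

theorem besselJ_neg_eq (ν : ℝ) {x : ℝ} (hx : 0 < x) :
    besselJ (-ν) x = besselJ ν x * Real.cos (ν * π) - Real.sin (ν * π) *
      (π * x / 2 * (modSq ν x * besselJ (ν + 1) x - modCross ν x * besselJ ν x)) := by
  have h1 := nicholsonForm_besselJ ν hx
  have h2 := nicholsonForm_besselJ_besselJ_neg ν hx
  have h4 := besselJ_cross ν hx
  rw [nicholsonForm] at h1 h2
  have h5 : 4 / π ^ 2 * besselJ (-ν) x = 4 / π ^ 2 * (besselJ ν x * Real.cos (ν * π) -
      Real.sin (ν * π) *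
      (π * x / 2 * (modSq ν x * besselJ (ν + 1) x - modCross ν x * besselJ ν x))) := by
    have e : 4 / π ^ 2 * (Real.sin (ν * π) * (π * x / 2 *
        (modSq ν x * besselJ (ν + 1) x - modCross ν x * besselJ ν x))) =
        2 * Real.sin (ν * π) / π *
        (x * (modSq ν x * besselJ (ν + 1) x - modCross ν x * besselJ ν x)) := by
      field_simp
      ring
    rw [mul_sub, e]
    linear_combination besselJ ν x * h2 - besselJ (-ν) x * h1 +
      x * (modSq ν x * besselJ (ν + 1) x - modCross ν x * besselJ ν x) * h4
  exact mul_left_cancel₀ (by positivity) h5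

/-- `Y_ν` in terms of `J_ν`, `J_{ν+1}` and Nicholson's integrals. Both sides are continuous in the
order, so that the integer orders need no separate treatment. -/
theorem besselY_eq (ν : ℝ) {x : ℝ} (hx : 0 < x) :
    besselY ν x = π * x / 2 * (modSq ν x * besselJ (ν + 1) x - modCross ν x * besselJ ν x) := by
  have hq : ∀ μ : ℝ, Real.sin (μ * π) ≠ 0 →
      (besselJ μ x * Real.cos (μ * π) - besselJ (-μ) x) / Real.sin (μ * π) =
      π * x / 2 * (modSq μ x * besselJ (μ + 1) x - modCross μ x * besselJ μ x) := by
    intro μ hμ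
    rw [besselJ_neg_eq μ hx]
    field_simp
    ring
  by_cases h : ∃ n : ℤ, ν = n
  · obtain ⟨n, rfl⟩ := h
    have hc : ContinuousAt (fun μ : ℝ => π * x / 2 * (modSq μ x * besselJ (μ + 1) x -
        modCross μ x * besselJ μ x)) n := by
      have h1 := (analyticAt_modSq (n : ℝ) hx).continuousAt
      have h2 := ((analyticAt_besselJ (n + 1 : ℝ) hx).fun_comp (f := fun ν : ℝ => ν + 1)
        (by fun_prop)).continuousAt
      have h3 := (analyticAt_modCross (n : ℝ) hx).continuousAt
      have h4 := (analyticAt_besselJ (n : ℝ) hx).continuousAt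
      exact continuousAt_const.mul ((h1.mul h2).sub (h3.mul h4))
    refine tendsto_nhds_unique (tendsto_besselY_int n x hx)
      ((hc.mono_left nhdsWithin_le_nhds).congr' ?_)
    have hI : Ioo ((n : ℝ) - 1) (n + 1) ∈ 𝓝[≠] (n : ℝ) :=
      mem_nhdsWithin_of_mem_nhds (Ioo_mem_nhds (by linarith) (by linarith))
    filter_upwards [hI, self_mem_nhdsWithin] with μ hμ hne
    refine (hq μ fun hs => ?_).symm
    obtain ⟨m, hm⟩ := Real.sin_eq_zero_iff.1 hs
    have hm' : (m : ℝ) = μ := mul_right_cancel₀ Real.pi_ne_zero hm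
    rw [← hm'] at hμ hne
    have h1 : n - 1 < m := by exact_mod_cast hμ.1
    have h2 : m < n + 1 := by exact_mod_cast hμ.2
    exact hne (by have : m = n := by omega
                  simp [this])
  · rw [besselY, if_neg h]
    refine hq ν fun hs => h ?_
    obtain ⟨m, hm⟩ := Real.sin_eq_zero_iff.1 hs
    exact ⟨m, (mul_right_cancel₀ Real.pi_ne_zero hm).symm⟩

theorem modCross_add_modCross (ν : ℝ) {x : ℝ} (hx : 0 < x) :
    modCross ν x + modCross (ν + 1) x = 2 * (ν + 1) / x * modSq (ν + 1) x := by
  have h := (hasDerivAt_modSq' (ν + 1) hx).unique (hasDerivAt_modSq_add_one ν hx)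
  linarith

theorem besselY_add_one (ν : ℝ) {x : ℝ} (hx : 0 < x) : besselY (ν + 1) x =
    π * x / 2 * (modCross ν x * besselJ (ν + 1) x - modSq (ν + 1) x * besselJ ν x) := by
  rw [besselY_eq _ hx, besselJ_recurrence ν hx]
  rw [show ν + 1 + 1 = ν + 2 by ring]
  have h := modCross_add_modCross ν hx
  linear_combination -(π * x / 2 * besselJ (ν + 1) x) * h

theorem hasDerivAt_besselY (ν : ℝ) {x : ℝ} (hx : 0 < x) :
    HasDerivAt (besselY ν) (ν / x * besselY ν x - besselY (ν + 1) x) x := by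
  have h1 := hasDerivAt_modSq' ν hx
  have h3 := hasDerivAt_modCross ν hx
  have h4 := hasDerivAt_besselJ ν hx
  have h5 := hasDerivAt_besselJ_add_one ν hx
  have h6 : HasDerivAt (fun x : ℝ => π * x / 2) (π / 2) x := by
    simpa using ((hasDerivAt_id x).const_mul π).div_const 2
  refine ((h6.mul ((h1.mul h5).sub (h3.mul h4))).congr_of_eventuallyEq ?_).congr_deriv ?_
  · filter_upwards [lt_mem_nhds hx] with y hy using besselY_eq ν hy
  · rw [besselY_eq ν hx, besselY_add_one ν hx]
    simp only [Pi.sub_apply, Pi.mul_apply]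
    field_simp
    ring

theorem hasDerivAt_besselY_add_one (ν : ℝ) {x : ℝ} (hx : 0 < x) :
    HasDerivAt (besselY (ν + 1)) (besselY ν x - (ν + 1) / x * besselY (ν + 1) x) x := by
  have h2 := hasDerivAt_modSq_add_one ν hx
  have h3 := hasDerivAt_modCross ν hx
  have h4 := hasDerivAt_besselJ ν hx
  have h5 := hasDerivAt_besselJ_add_one ν hx
  have h6 : HasDerivAt (fun x : ℝ => π * x / 2) (π / 2) x := by
    simpa using ((hasDerivAt_id x).const_mul π).div_const 2
  refine ((h6.mul ((h3.mul h5).sub (h2.mul h4))).congr_of_eventuallyEq ?_).congr_deriv ?_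
  · filter_upwards [lt_mem_nhds hx] with y hy using besselY_add_one ν hy
  · rw [besselY_eq ν hx, besselY_add_one ν hx]
    simp only [Pi.sub_apply, Pi.mul_apply]
    field_simp
    ring

theorem form_div_sq (ν : ℝ) {x : ℝ} (hx : 0 < x) :
    π ^ 2 * x ^ 2 / 4 * (modSq ν x * besselJ (ν + 1) x ^ 2 + modSq (ν + 1) x * besselJ ν x ^ 2 -
      2 * modCross ν x * besselJ ν x * besselJ (ν + 1) x) = 1 := by
  have h := nicholsonForm_besselJ ν hx
  rw [nicholsonForm, eq_div_iff (by positivity)] at h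
  linear_combination h / 4

theorem det_div_sq (ν : ℝ) {x : ℝ} (hx : 0 < x) :
    π ^ 2 * x ^ 2 / 4 * (modSq ν x * modSq (ν + 1) x - modCross ν x ^ 2) = 1 := by
  have h := modSq_mul_modSq_sub ν hx
  rw [eq_div_iff (by positivity)] at h
  linear_combination h / 4

/-- Nicholson's formula. -/
theorem besselJ_sq_add_besselY_sq (ν : ℝ) {x : ℝ} (hx : 0 < x) :
    besselJ ν x ^ 2 + besselY ν x ^ 2 = modSq ν x := by
  rw [besselY_eq ν hx]
  linear_combination modSq ν x * form_div_sq ν hx - besselJ ν x ^ 2 * det_div_sq ν hx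

theorem besselJ_mul_add_besselY_mul (ν : ℝ) {x : ℝ} (hx : 0 < x) :
    besselJ ν x * besselJ (ν + 1) x + besselY ν x * besselY (ν + 1) x = modCross ν x := by
  rw [besselY_eq ν hx, besselY_add_one ν hx]
  linear_combination modCross ν x * form_div_sq ν hx -
    besselJ ν x * besselJ (ν + 1) x * det_div_sq ν hx

/-- The Wronskian of `J_ν` and `Y_ν`, in terms of neighbouring orders. -/
theorem besselJ_mul_besselY_sub (ν : ℝ) {x : ℝ} (hx : 0 < x) :
    besselJ (ν + 1) x * besselY ν x - besselJ ν x * besselY (ν + 1) x = 2 / (π * x) := by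
  rw [besselY_eq ν hx, besselY_add_one ν hx, eq_div_iff (by positivity)]
  linear_combination 2 * form_div_sq ν hx

/-! ### Signs near zero -/

theorem eventually_besselJ_pos {ν : ℝ} (hν : 0 < ν) : ∀ᶠ x in 𝓝[>] (0 : ℝ), 0 < besselJ ν x := by
  have h := (tendsto_entireJ_zero ν).eventually
    (lt_mem_nhds (inv_pos.2 (Real.Gamma_pos_of_pos (show 0 < ν + 1 by linarith))))
  filter_upwards [h, self_mem_nhdsWithin] with x hx (hx0 : 0 < x)
  rw [besselJ_eq ν hx0]
  positivity

theorem eventually_mul_besselJ_add_one_lt {ν : ℝ} (hν : 0 < ν) :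
    ∀ᶠ x in 𝓝[>] (0 : ℝ), x * besselJ (ν + 1) x < ν * besselJ ν x := by
  have hx2 : Tendsto (fun x : ℝ => x ^ 2 / 2) (𝓝[>] 0) (𝓝 0) := by
    have : Continuous fun x : ℝ => x ^ 2 / 2 := by fun_prop
    have h := this.tendsto 0
    norm_num at h
    exact h.mono_left nhdsWithin_le_nhds
  have h1 := hx2.mul (tendsto_entireJ_zero (ν + 1))
  have h2 := (tendsto_entireJ_zero ν).const_mul ν
  have hG : 0 < (Real.Gamma (ν + 1))⁻¹ := inv_pos.2 (Real.Gamma_pos_of_pos (by linarith))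
  have h := h1.eventually_lt h2 (by rw [zero_mul]; positivity)
  filter_upwards [h, self_mem_nhdsWithin] with x hx (hx0 : 0 < x)
  have hx2 : 0 < x / 2 := by positivity
  rw [besselJ_eq _ hx0, besselJ_eq _ hx0, Real.rpow_add_one hx2.ne']
  have := mul_lt_mul_of_pos_left hx (Real.rpow_pos_of_pos hx2 ν)
  linear_combination this

theorem eventually_besselY_neg {ν : ℝ} (hν : 0 < ν) : ∀ᶠ x in 𝓝[>] (0 : ℝ), besselY ν x < 0 := by
  filter_upwards [eventually_besselJ_pos hν, eventually_mul_besselJ_add_one_lt hν,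
    self_mem_nhdsWithin] with x h1 h2 (hx : 0 < x)
  have h3 := modSq_pos ν hx
  have h4 := modDeriv_pos ν hx
  have h5 := mul_modCross ν hx
  have e : besselY ν x = π / 2 * (modSq ν x * (x * besselJ (ν + 1) x - ν * besselJ ν x) -
      modDeriv ν x * besselJ ν x) := by
    rw [besselY_eq ν hx]
    linear_combination -(π / 2 * besselJ ν x) * h5
  rw [e]
  have h6 : modSq ν x * (x * besselJ (ν + 1) x - ν * besselJ ν x) < 0 :=
    mul_neg_of_pos_of_neg h3 (by linarith)
  have h7 := mul_pos h4 h1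
  exact mul_neg_of_pos_of_neg (by positivity) (by linarith)

theorem tendsto_besselJ_sq_div_modSq {ν : ℝ} (hν : 0 < ν) :
    Tendsto (fun x => besselJ ν x ^ 2 / modSq ν x) (𝓝[>] 0) (𝓝 0) := by
  have hx : Tendsto (fun x : ℝ => x ^ (4 * ν)) (𝓝[>] 0) (𝓝 0) := by
    have h := (Real.continuous_rpow_const (show 0 ≤ 4 * ν by positivity)).tendsto 0
    rw [Real.zero_rpow (by positivity)] at h
    exact h.mono_left nhdsWithin_le_nhds
  have hG := Real.Gamma_pos_of_pos hν
  have h := (hx.mul (((tendsto_entireJ_zero ν).pow 2).div_const (2 ^ (2 * ν)))).div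
    (tendsto_rpow_mul_modSq_zero hν) (by positivity)
  rw [zero_mul, zero_div] at h
  refine h.congr' ?_
  filter_upwards [self_mem_nhdsWithin] with y (hy : 0 < y)
  have hy2 : 0 < y / 2 := by positivity
  have hF := modSq_pos ν hy
  simp only [Pi.div_apply]
  rw [besselJ_eq _ hy, mul_pow, ← Real.rpow_natCast ((y / 2) ^ ν), ← Real.rpow_mul hy2.le,
    show ν * ((2 : ℕ) : ℝ) = 2 * ν by push_cast; ring, Real.div_rpow hy.le zero_le_two,
    show 4 * ν = 2 * ν + 2 * ν by ring, Real.rpow_add hy]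
  have := Real.rpow_pos_of_pos hy (2 * ν)
  field_simp

/-! ### The phase of the Bessel functions -/

/-- The phase `θ_ν` of the Bessel functions: `J_ν = √(modSq ν) cos θ_ν` and
`Y_ν = √(modSq ν) sin θ_ν`, with `θ_ν(0) = -π / 2`. -/
noncomputable def phase (ν x : ℝ) : ℝ := -(π / 2) + ∫ t in (0 : ℝ)..x, 2 / (π * t * modSq ν t)

theorem continuousOn_modSq (ν : ℝ) : ContinuousOn (modSq ν) (Ioi 0) :=
  fun _ hx => (hasDerivAt_modSq ν hx).continuousAt.continuousWithinAt

theorem continuousOn_phase_deriv (ν : ℝ) :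
    ContinuousOn (fun t => 2 / (π * t * modSq ν t)) (Ioi 0) := by
  refine continuousOn_const.div ((by fun_prop : ContinuousOn (fun t : ℝ => π * t) (Ioi 0)).mul
    (continuousOn_modSq ν)) fun t (ht : 0 < t) => ?_
  have := modSq_pos ν ht
  positivity

theorem phase_deriv_pos (ν : ℝ) {x : ℝ} (hx : 0 < x) : 0 < 2 / (π * x * modSq ν x) := by
  have := modSq_pos ν hx
  positivity

/-- Near `0` the derivative of the phase is of order `t ^ (2 ν - 1)`. -/
theorem intervalIntegrable_phase_deriv {ν : ℝ} (hν : 0 < ν) {x : ℝ} (hx : 0 ≤ x) :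
    IntervalIntegrable (fun t => 2 / (π * t * modSq ν t)) volume 0 x := by
  have hG := Real.Gamma_pos_of_pos hν
  set c := 4 ^ ν * Real.Gamma ν ^ 2 / π ^ 2 with hc
  have hc0 : 0 < c := by positivity
  have h := (tendsto_rpow_mul_modSq_zero hν).eventually (lt_mem_nhds (half_lt_self hc0))
  obtain ⟨δ, hδ, hδ'⟩ := mem_nhdsGT_iff_exists_Ioo_subset.1 h
  have hδ0 : 0 < δ := hδ
  have h1 : IntervalIntegrable (fun t => 2 / (π * t * modSq ν t)) volume 0 (δ / 2) := by
    have hr : IntervalIntegrable (fun t : ℝ => 4 / (π * c) * t ^ (2 * ν - 1)) volume 0 (δ / 2) :=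
      (intervalIntegral.intervalIntegrable_rpow' (by linarith)).const_mul _
    rw [intervalIntegrable_iff_integrableOn_Ioc_of_le (by positivity)] at hr ⊢
    refine hr.mono' (((continuousOn_phase_deriv ν).mono fun t ht => ht.1).aestronglyMeasurable
      measurableSet_Ioc) ?_
    filter_upwards [ae_restrict_mem measurableSet_Ioc] with t ht
    have ht0 : 0 < t := ht.1
    have h2 : c / 2 < t ^ (2 * ν) * modSq ν t := hδ' ⟨ht0, by linarith [ht.2]⟩
    have hF := modSq_pos ν ht0
    have ht2 := Real.rpow_pos_of_pos ht0 (2 * ν)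
    rw [Real.norm_of_nonneg (phase_deriv_pos ν ht0).le, Real.rpow_sub_one ht0.ne']
    rw [div_mul_div_comm, div_le_div_iff₀ (by positivity) (by positivity)]
    have h3 : 0 < π * t := by positivity
    nlinarith [mul_lt_mul_of_pos_left h2 h3]
  have h2 : IntervalIntegrable (fun t => 2 / (π * t * modSq ν t)) volume (δ / 2) x := by
    rcases hx.eq_or_lt with rfl | hx
    · exact h1.symm
    · refine ((continuousOn_phase_deriv ν).mono fun t ht => ?_).intervalIntegrable
      have := ht.1
      exact lt_of_lt_of_le (lt_min (by positivity) hx) this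
  exact h1.trans h2

theorem hasDerivAt_phase {ν : ℝ} (hν : 0 < ν) {x : ℝ} (hx : 0 < x) :
    HasDerivAt (phase ν) (2 / (π * x * modSq ν x)) x := by
  refine (intervalIntegral.integral_hasDerivAt_right (intervalIntegrable_phase_deriv hν hx.le)
    ?_ ((continuousOn_phase_deriv ν).continuousAt (Ioi_mem_nhds hx))).const_add _
  exact (continuousOn_phase_deriv ν).stronglyMeasurableAtFilter isOpen_Ioi x hx

theorem tendsto_phase_zero {ν : ℝ} (hν : 0 < ν) :
    Tendsto (phase ν) (𝓝[>] 0) (𝓝 (-(π / 2))) := by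
  have hi := intervalIntegrable_phase_deriv hν zero_le_one
  have hc := intervalIntegral.continuousOn_primitive_interval
    (f := fun t => 2 / (π * t * modSq ν t)) (μ := volume) (a := 0) (b := 1)
    ((intervalIntegrable_iff_integrableOn_Icc_of_le zero_le_one).1 hi |>.mono_set
      (by rw [uIcc_of_le zero_le_one]))
  have h := (hc 0 (by simp)).tendsto
  rw [intervalIntegral.integral_same, uIcc_of_le zero_le_one] at h
  have h2 : Tendsto (fun x => ∫ t in (0 : ℝ)..x, 2 / (π * t * modSq ν t)) (𝓝[>] 0) (𝓝 0) := by
    refine h.mono_left ?_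
    rw [← nhdsWithin_Ioo_eq_nhdsGT (zero_lt_one (α := ℝ))]
    exact nhdsWithin_mono _ Ioo_subset_Icc_self
  have h3 := h2.const_add (-(π / 2))
  rw [add_zero] at h3
  exact h3

theorem continuousOn_phase {ν : ℝ} (hν : 0 < ν) : ContinuousOn (phase ν) (Ioi 0) :=
  fun _ hx => (hasDerivAt_phase hν hx).continuousAt.continuousWithinAt

theorem hasDerivAt_sqrt_modSq (ν : ℝ) {x : ℝ} (hx : 0 < x) :
    HasDerivAt (fun x => √(modSq ν x))
      ((2 * ν / x * modSq ν x - 2 * modCross ν x) / (2 * √(modSq ν x))) x :=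
  (hasDerivAt_modSq' ν hx).sqrt (modSq_pos ν hx).ne'

theorem hasDerivAt_besselJ_div_sqrt (ν : ℝ) {x : ℝ} (hx : 0 < x) :
    HasDerivAt (fun x => besselJ ν x / √(modSq ν x))
      (-(2 / (π * x * modSq ν x) * (besselY ν x / √(modSq ν x)))) x := by
  have hF := modSq_pos ν hx
  have hs := Real.sqrt_pos.2 hF
  refine ((hasDerivAt_besselJ ν hx).div (hasDerivAt_sqrt_modSq ν hx) hs.ne').congr_deriv ?_
  have h1 := besselJ_mul_besselY_sub ν hx
  have h2 := besselJ_sq_add_besselY_sq ν hx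
  have h3 := besselJ_mul_add_besselY_mul ν hx
  have hsq : √(modSq ν x) ^ 2 = modSq ν x := Real.sq_sqrt hF.le
  have h4 : 2 / (π * x * modSq ν x) = 2 / (π * x) / modSq ν x := by rw [div_div]
  rw [h4, ← h1]
  set s := √(modSq ν x) with hs'
  rw [← hsq] at h2 ⊢
  rw [← h3]
  field_simp
  linear_combination (x * besselJ (ν + 1) x) * h2

theorem hasDerivAt_besselY_div_sqrt (ν : ℝ) {x : ℝ} (hx : 0 < x) :
    HasDerivAt (fun x => besselY ν x / √(modSq ν x))
      (2 / (π * x * modSq ν x) * (besselJ ν x / √(modSq ν x))) x := by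
  have hF := modSq_pos ν hx
  have hs := Real.sqrt_pos.2 hF
  refine ((hasDerivAt_besselY ν hx).div (hasDerivAt_sqrt_modSq ν hx) hs.ne').congr_deriv ?_
  have h1 := besselJ_mul_besselY_sub ν hx
  have h2 := besselJ_sq_add_besselY_sq ν hx
  have h3 := besselJ_mul_add_besselY_mul ν hx
  have hsq : √(modSq ν x) ^ 2 = modSq ν x := Real.sq_sqrt hF.le
  have h4 : 2 / (π * x * modSq ν x) = 2 / (π * x) / modSq ν x := by rw [div_div]
  rw [h4, ← h1]
  set s := √(modSq ν x) with hs'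
  rw [← hsq] at h2 ⊢
  rw [← h3]
  field_simp
  linear_combination (x * besselY (ν + 1) x) * h2

theorem tendsto_besselJ_div_sqrt {ν : ℝ} (hν : 0 < ν) :
    Tendsto (fun x => besselJ ν x / √(modSq ν x)) (𝓝[>] 0) (𝓝 0) := by
  have h := (tendsto_besselJ_sq_div_modSq hν).sqrt
  rw [Real.sqrt_zero] at h
  refine h.congr' ?_
  filter_upwards [eventually_besselJ_pos hν] with x hx
  rw [Real.sqrt_div (sq_nonneg _), Real.sqrt_sq hx.le]

theorem tendsto_besselY_div_sqrt {ν : ℝ} (hν : 0 < ν) :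
    Tendsto (fun x => besselY ν x / √(modSq ν x)) (𝓝[>] 0) (𝓝 (-1)) := by
  have h := ((tendsto_besselJ_sq_div_modSq hν).const_sub 1).sqrt.neg
  rw [sub_zero, Real.sqrt_one] at h
  refine h.congr' ?_
  filter_upwards [eventually_besselY_neg hν, self_mem_nhdsWithin] with x hx (hx0 : 0 < x)
  have hF := modSq_pos ν hx0
  rw [one_sub_div hF.ne', ← besselJ_sq_add_besselY_sq ν hx0, add_sub_cancel_left,
    Real.sqrt_div (sq_nonneg _), Real.sqrt_sq_eq_abs, abs_of_neg hx, neg_div, neg_neg]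

/-- The Bessel functions in polar coordinates: the point `(J_ν, Y_ν) / √(modSq ν)` of the unit
circle rotates with the angular velocity of the phase, and starts at the angle `-π / 2`. -/
theorem besselJ_eq_cos_and_besselY_eq_sin {ν : ℝ} (hν : 0 < ν) {x : ℝ} (hx : 0 < x) :
    besselJ ν x = √(modSq ν x) * Real.cos (phase ν x) ∧
    besselY ν x = √(modSq ν x) * Real.sin (phase ν x) := by
  have hcos : Tendsto (fun x => Real.cos (phase ν x)) (𝓝[>] 0) (𝓝 0) := by
    have h := (Real.continuous_cos.tendsto _).comp (tendsto_phase_zero hν)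
    rwa [Real.cos_neg, Real.cos_pi_div_two] at h
  have hsin : Tendsto (fun x => Real.sin (phase ν x)) (𝓝[>] 0) (𝓝 (-1)) := by
    have h := (Real.continuous_sin.tendsto _).comp (tendsto_phase_zero hν)
    rwa [Real.sin_neg, Real.sin_pi_div_two] at h
  have hJ := tendsto_besselJ_div_sqrt hν
  have hY := tendsto_besselY_div_sqrt hν
  have hp : besselJ ν x / √(modSq ν x) * Real.cos (phase ν x) +
      besselY ν x / √(modSq ν x) * Real.sin (phase ν x) = 1 := by
    refine eq_of_hasDerivAt_zero (l := 𝓝[>] (0 : ℝ)) (f := fun x => besselJ ν x / √(modSq ν x) *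
      Real.cos (phase ν x) + besselY ν x / √(modSq ν x) * Real.sin (phase ν x)) (fun y hy => ?_)
      self_mem_nhdsWithin ?_ hx
    · have h := hasDerivAt_phase hν hy
      refine (((hasDerivAt_besselJ_div_sqrt ν hy).mul h.cos).add
        ((hasDerivAt_besselY_div_sqrt ν hy).mul h.sin)).congr_deriv ?_
      ring
    · simpa using (hJ.mul hcos).add (hY.mul hsin)
  have hr : besselY ν x / √(modSq ν x) * Real.cos (phase ν x) -
      besselJ ν x / √(modSq ν x) * Real.sin (phase ν x) = 0 := by
    refine eq_of_hasDerivAt_zero (l := 𝓝[>] (0 : ℝ)) (f := fun x => besselY ν x / √(modSq ν x) *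
      Real.cos (phase ν x) - besselJ ν x / √(modSq ν x) * Real.sin (phase ν x)) (fun y hy => ?_)
      self_mem_nhdsWithin ?_ hx
    · have h := hasDerivAt_phase hν hy
      refine (((hasDerivAt_besselY_div_sqrt ν hy).mul h.cos).sub
        ((hasDerivAt_besselJ_div_sqrt ν hy).mul h.sin)).congr_deriv ?_
      ring
    · simpa using (hY.mul hcos).sub (hJ.mul hsin)
  have hs := Real.sqrt_pos.2 (modSq_pos ν hx)
  have h1 := Real.sin_sq_add_cos_sq (phase ν x)
  have hJ' : besselJ ν x / √(modSq ν x) = Real.cos (phase ν x) := by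
    linear_combination Real.cos (phase ν x) * hp - Real.sin (phase ν x) * hr -
      besselJ ν x / √(modSq ν x) * h1
  have hY' : besselY ν x / √(modSq ν x) = Real.sin (phase ν x) := by
    linear_combination Real.sin (phase ν x) * hp + Real.cos (phase ν x) * hr -
      besselY ν x / √(modSq ν x) * h1
  rw [← hJ', ← hY', mul_div_cancel₀ _ hs.ne', mul_div_cancel₀ _ hs.ne']
  exact ⟨rfl, rfl⟩

theorem strictMonoOn_phase {ν : ℝ} (hν : 0 < ν) : StrictMonoOn (phase ν) (Ioi 0) := by
  refine strictMonoOn_of_deriv_pos (convex_Ioi 0) (continuousOn_phase hν) fun x hx => ?_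
  rw [interior_Ioi] at hx
  rw [(hasDerivAt_phase hν hx).deriv]
  exact phase_deriv_pos ν hx

theorem tendsto_phase_atTop {ν : ℝ} (hν : 0 < ν) : Tendsto (phase ν) atTop atTop := by
  -- The derivative of the phase tends to `1`, and so is eventually at least `1 / 2`.
  have h := (tendsto_mul_modSq_atTop ν).eventually
    (gt_mem_nhds (show 2 / π < 4 / π by gcongr; norm_num))
  obtain ⟨a, ha⟩ := eventually_atTop.1 (h.and (eventually_gt_atTop 0))
  have ha0 : 0 < a := (ha a le_rfl).2
  have hmono : MonotoneOn (fun x => phase ν x - x / 2) (Ici a) := by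
    have hd : ∀ x, a ≤ x → HasDerivAt (fun x => phase ν x - x / 2)
        (2 / (π * x * modSq ν x) - 1 / 2) x := fun x hx =>
      (hasDerivAt_phase hν (ha0.trans_le hx)).sub ((hasDerivAt_id x).div_const 2)
    refine monotoneOn_of_deriv_nonneg (convex_Ici a)
      (fun x hx => (hd x hx).continuousAt.continuousWithinAt)
      (fun x hx => (hd x (interior_subset hx)).differentiableAt.differentiableWithinAt)
      fun x hx => ?_
    have hx' := interior_subset hx
    rw [(hd x hx').deriv, sub_nonneg]
    have hx0 := (ha x hx').2
    have hF := modSq_pos ν hx0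
    rw [div_le_div_iff₀ two_pos (by positivity)]
    have := (ha x hx').1
    rw [lt_div_iff₀ Real.pi_pos] at this
    linarith
  refine tendsto_atTop_mono' _ (f₁ := fun x => (phase ν a - a / 2) + x / 2) ?_
    (tendsto_atTop_add_const_left _ _ (tendsto_id.atTop_div_const two_pos))
  filter_upwards [eventually_ge_atTop a] with x hx
  have := hmono self_mem_Ici hx hx
  simp only at this
  linarith

theorem strictMonoOn_phase_sub {μ ν : ℝ} (hμ : 0 < μ) (h : μ < ν) :
    StrictMonoOn (fun x => phase μ x - phase ν x) (Ioi 0) := by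
  have hν := hμ.trans h
  refine strictMonoOn_of_deriv_pos (convex_Ioi 0)
    ((continuousOn_phase hμ).sub (continuousOn_phase hν)) fun x hx => ?_
  rw [interior_Ioi] at hx
  have hx0 : 0 < x := hx
  rw [((hasDerivAt_phase hμ hx0).fun_sub (hasDerivAt_phase hν hx0)).deriv, sub_pos]
  have hF := modSq_pos μ hx0
  have := modSq_lt_modSq hμ.le h hx0
  gcongr

theorem tendsto_phase_sub_zero {μ ν : ℝ} (hμ : 0 < μ) (hν : 0 < ν) :
    Tendsto (fun x => phase μ x - phase ν x) (𝓝[>] 0) (𝓝 0) := by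
  simpa using (tendsto_phase_zero hμ).sub (tendsto_phase_zero hν)

theorem phase_lt_phase {μ ν : ℝ} (hμ : 0 < μ) (h : μ < ν) {x : ℝ} (hx : 0 < x) :
    phase ν x < phase μ x := by
  have hm := strictMonoOn_phase_sub hμ h
  have h1 : 0 ≤ phase μ (x / 2) - phase ν (x / 2) := by
    refine le_of_tendsto (tendsto_phase_sub_zero hμ (hμ.trans h)) ?_
    filter_upwards [Ioo_mem_nhdsGT (half_pos hx)] with y hy
    exact (hm hy.1 (half_pos hx) hy.2).le
  have h2 := hm (half_pos hx) hx (half_lt_self hx)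
  simp only at h2
  linarith

/-- The phases of the orders `ν` and `ν + 1` differ by less than a right angle, because the cosine
of their difference has the sign of `modCross ν`. -/
theorem phase_sub_phase_add_one_lt {ν : ℝ} (hν : 0 < ν) {x : ℝ} (hx : 0 < x) :
    phase ν x - phase (ν + 1) x < π / 2 := by
  have hν1 : 0 < ν + 1 := by linarith
  by_contra! hge
  have hc : ContinuousOn (fun x => phase ν x - phase (ν + 1) x) (Ioi 0) :=
    (continuousOn_phase hν).sub (continuousOn_phase hν1)
  obtain ⟨y, hy, hy'⟩ := (((tendsto_phase_sub_zero hν hν1).eventually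
    (gt_mem_nhds Real.pi_div_two_pos)).and (Ioo_mem_nhdsGT hx)).exists
  obtain ⟨z, hz, hz'⟩ := intermediate_value_Icc hy'.2.le
    (hc.mono fun t ht => hy'.1.trans_le ht.1) ⟨hy.le, hge⟩
  have hz0 : 0 < z := hy'.1.trans_le hz.1
  have h1 := besselJ_mul_add_besselY_mul ν hz0
  have h2 := modCross_pos hν.le hz0
  simp only at hz'
  rw [(besselJ_eq_cos_and_besselY_eq_sin hν hz0).1, (besselJ_eq_cos_and_besselY_eq_sin hν hz0).2,
    (besselJ_eq_cos_and_besselY_eq_sin hν1 hz0).1,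
    (besselJ_eq_cos_and_besselY_eq_sin hν1 hz0).2] at h1
  have h3 : Real.cos (phase ν z - phase (ν + 1) z) = 0 := by rw [hz', Real.cos_pi_div_two]
  rw [Real.cos_sub] at h3
  have h4 : modCross ν z = 0 := by
    rw [← h1]
    linear_combination √(modSq ν z) * √(modSq (ν + 1) z) * h3
  linarith

theorem tendsto_phase_sub_phase_add_one {ν : ℝ} (hν : 0 < ν) :
    Tendsto (fun x => phase ν x - phase (ν + 1) x) atTop (𝓝 (π / 2)) := by
  have hν1 : 0 < ν + 1 := by linarith
  have h1 := ((tendsto_mul_modSq_atTop ν).mul (tendsto_mul_modSq_atTop (ν + 1))).sqrt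
  have h2 := (tendsto_mul_modCross_atTop ν).div h1 (by positivity)
  rw [zero_div] at h2
  have h3 := (Real.continuous_arccos.tendsto 0).comp h2
  rw [Real.arccos_zero] at h3
  refine h3.congr' ?_
  filter_upwards [eventually_gt_atTop 0] with x hx
  have hD0 := phase_lt_phase hν (lt_add_one ν) hx
  have hD1 := phase_sub_phase_add_one_lt hν hx
  have hF := modSq_pos ν hx
  have hG := modSq_pos (ν + 1) hx
  have e : x * modCross ν x / √(x * modSq ν x * (x * modSq (ν + 1) x)) =
      Real.cos (phase ν x - phase (ν + 1) x) := by
    rw [show x * modSq ν x * (x * modSq (ν + 1) x) = x ^ 2 * (modSq ν x * modSq (ν + 1) x) by ring,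
      Real.sqrt_mul (by positivity), Real.sqrt_sq hx.le, Real.sqrt_mul hF.le,
      ← besselJ_mul_add_besselY_mul ν hx, (besselJ_eq_cos_and_besselY_eq_sin hν hx).1,
      (besselJ_eq_cos_and_besselY_eq_sin hν hx).2, (besselJ_eq_cos_and_besselY_eq_sin hν1 hx).1,
      (besselJ_eq_cos_and_besselY_eq_sin hν1 hx).2, Real.cos_sub]
    have := Real.sqrt_pos.2 hF
    have := Real.sqrt_pos.2 hG
    field_simp
  simp only [Function.comp_apply, Pi.div_apply]
  rw [e, Real.arccos_cos (by linarith) (by linarith [Real.pi_pos])]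

/-! ### The Wronskian of Bessel functions of different orders -/

/-- The Wronskian `x (J_ν(x) Y_μ'(x) - J_ν'(x) Y_μ(x))`, with the derivatives expressed by
neighbouring orders. -/
noncomputable def wronskianJY (ν μ x : ℝ) : ℝ :=
  (μ - ν) * (besselJ ν x * besselY μ x) - x * (besselJ ν x * besselY (μ + 1) x) +
    x * (besselJ (ν + 1) x * besselY μ x)

theorem riccatiWronskian_eq (L l : ℝ) {x : ℝ} (hx : 0 < x) :
    riccatiWronskian L l x = π / 2 * wronskianJY (L + 1 / 2) (l + 1 / 2) x := by
  have hs : HasDerivAt (fun x => √(π * x / 2)) (π / 2 / (2 * √(π * x / 2))) x := by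
    have h : HasDerivAt (fun x : ℝ => π * x / 2) (π / 2) x := by
      simpa using ((hasDerivAt_id x).const_mul π).div_const 2
    exact h.sqrt (by positivity)
  have hU : deriv (riccatiU L) x = _ := (hs.mul (hasDerivAt_besselJ (L + 1 / 2) hx)).deriv
  have hV : deriv (riccatiV l) x = _ := (hs.mul (hasDerivAt_besselY (l + 1 / 2) hx)).deriv
  have hsq : √(π * x / 2) ^ 2 = π * x / 2 := Real.sq_sqrt (by positivity)
  have hs0 : 0 < √(π * x / 2) := Real.sqrt_pos.2 (by positivity)
  rw [riccatiWronskian, hU, hV, riccatiU, riccatiV, wronskianJY]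
  set s := √(π * x / 2) with hs'
  have e : π = 2 * s ^ 2 / x := by rw [hsq]; field_simp
  rw [show π / 2 = s ^ 2 / x by rw [e]; field_simp]
  field_simp
  ring

theorem hasDerivAt_wronskianJY (ν μ : ℝ) {x : ℝ} (hx : 0 < x) :
    HasDerivAt (wronskianJY ν μ) ((μ ^ 2 - ν ^ 2) / x * (besselJ ν x * besselY μ x)) x := by
  have h1 := hasDerivAt_besselJ ν hx
  have h2 := hasDerivAt_besselJ_add_one ν hx
  have h3 := hasDerivAt_besselY μ hx
  have h4 := hasDerivAt_besselY_add_one μ hx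
  have h5 := hasDerivAt_id x
  refine ((((h1.mul h3).const_mul (μ - ν)).sub (h5.mul (h1.mul h4))).add
    (h5.mul (h2.mul h3))).congr_deriv ?_
  simp only [id, Pi.mul_apply]
  field_simp
  ring

theorem continuousOn_wronskianJY (ν μ : ℝ) : ContinuousOn (wronskianJY ν μ) (Ioi 0) :=
  fun _ hx => (hasDerivAt_wronskianJY ν μ hx).continuousAt.continuousWithinAt

/-- Near `0` the functions `J_ν`, `J_ν'`, `-Y_μ` and `Y_μ'` are positive. -/
theorem eventually_wronskianJY_pos {ν μ : ℝ} (hν : 0 < ν) (hμ : 0 < μ) :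
    ∀ᶠ x in 𝓝[>] (0 : ℝ), 0 < wronskianJY ν μ x := by
  filter_upwards [eventually_besselJ_pos hν, eventually_mul_besselJ_add_one_lt hν,
    eventually_besselJ_pos hμ, eventually_mul_besselJ_add_one_lt hμ, eventually_besselY_neg hμ,
    self_mem_nhdsWithin] with x h1 h2 h3 h4 h5 (hx : 0 < x)
  have h6 := modDeriv_pos μ hx
  have h7 := mul_modCross μ hx
  rw [← besselJ_mul_add_besselY_mul μ hx, ← besselJ_sq_add_besselY_sq μ hx] at h7
  -- The sign of `Y_μ'` is found from the decrease of `J_μ² + Y_μ²`.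
  have h8 : 0 < μ * besselY μ x - x * besselY (μ + 1) x := by
    have h9 : besselY μ x * (μ * besselY μ x - x * besselY (μ + 1) x) < 0 := by
      have := mul_pos h3 (sub_pos.2 h4)
      linear_combination h6 + this - h7
    exact pos_of_mul_neg_right h9 h5.le
  have e : wronskianJY ν μ x = besselJ ν x * (μ * besselY μ x - x * besselY (μ + 1) x) +
      (ν * besselJ ν x - x * besselJ (ν + 1) x) * -besselY μ x := by
    rw [wronskianJY]; ring
  rw [e]
  exact add_pos (mul_pos h1 h8) (mul_pos (sub_pos.2 h2) (neg_pos.2 h5))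

/-- At the zeros of `J_ν` the sign of the Wronskian is that of the cosine of the difference of the
phases. -/
theorem wronskianJY_of_besselJ_eq_zero {ν μ : ℝ} (hν : 0 < ν) (hμ : 0 < μ) {x : ℝ} (hx : 0 < x)
    (h : besselJ ν x = 0) :
    ∃ c, 0 < c ∧ wronskianJY ν μ x = c * Real.cos (phase μ x - phase ν x) := by
  have hF := Real.sqrt_pos.2 (modSq_pos ν hx)
  have hG := Real.sqrt_pos.2 (modSq_pos μ hx)
  refine ⟨2 / π * √(modSq μ x) / √(modSq ν x), by positivity, ?_⟩
  have h1 := besselJ_mul_besselY_sub ν hx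
  obtain ⟨hJ, hY⟩ := besselJ_eq_cos_and_besselY_eq_sin hν hx
  obtain ⟨-, hY'⟩ := besselJ_eq_cos_and_besselY_eq_sin hμ hx
  have hc : Real.cos (phase ν x) = 0 := by
    rw [h] at hJ
    exact (mul_eq_zero.1 hJ.symm).resolve_left hF.ne'
  have hs : Real.sin (phase ν x) ^ 2 = 1 := by
    have := Real.sin_sq_add_cos_sq (phase ν x)
    rw [hc] at this
    linarith
  rw [h, zero_mul, sub_zero, hY, eq_div_iff (by positivity)] at h1
  rw [wronskianJY, h, hY', Real.cos_sub, hc, div_mul_eq_mul_div, eq_div_iff hF.ne']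
  have e : 2 / π = x * (besselJ (ν + 1) x * (√(modSq ν x) * Real.sin (phase ν x))) := by
    rw [div_eq_iff Real.pi_ne_zero, ← h1]
    ring
  rw [e]
  linear_combination (-(x * besselJ (ν + 1) x * √(modSq ν x) * √(modSq μ x) *
    Real.sin (phase μ x))) * hs

/-- At the zeros of `Y_μ` the sign of the Wronskian is that of the cosine of the difference of the
phases. -/
theorem wronskianJY_of_besselY_eq_zero {ν μ : ℝ} (hν : 0 < ν) (hμ : 0 < μ) {x : ℝ} (hx : 0 < x)
    (h : besselY μ x = 0) :
    ∃ c, 0 < c ∧ wronskianJY ν μ x = c * Real.cos (phase μ x - phase ν x) := by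
  have hF := Real.sqrt_pos.2 (modSq_pos ν hx)
  have hG := Real.sqrt_pos.2 (modSq_pos μ hx)
  refine ⟨2 / π * √(modSq ν x) / √(modSq μ x), by positivity, ?_⟩
  have h1 := besselJ_mul_besselY_sub μ hx
  obtain ⟨hJ, hY⟩ := besselJ_eq_cos_and_besselY_eq_sin hμ hx
  obtain ⟨hJ', -⟩ := besselJ_eq_cos_and_besselY_eq_sin hν hx
  have hs : Real.sin (phase μ x) = 0 := by
    rw [h] at hY
    exact (mul_eq_zero.1 hY.symm).resolve_left hG.ne'
  have hc : Real.cos (phase μ x) ^ 2 = 1 := by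
    have := Real.sin_sq_add_cos_sq (phase μ x)
    rw [hs] at this
    linarith
  rw [h, mul_zero, zero_sub, hJ, eq_div_iff (by positivity)] at h1
  rw [wronskianJY, h, hJ', Real.cos_sub, hs, div_mul_eq_mul_div, eq_div_iff hG.ne']
  have e : 2 / π = -(x * (√(modSq μ x) * Real.cos (phase μ x) * besselY (μ + 1) x)) := by
    rw [div_eq_iff Real.pi_ne_zero, ← h1]
    ring
  rw [e]
  linear_combination (x * besselY (μ + 1) x * √(modSq ν x) * √(modSq μ x) *
    Real.cos (phase ν x)) * hc

theorem exists_phase_eq {ν : ℝ} (hν : 0 < ν) {x a : ℝ} (hx : 0 < x) (ha : phase ν x ≤ a) :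
    ∃ y, x ≤ y ∧ phase ν y = a := by
  obtain ⟨z, hz, hxz⟩ := (((tendsto_phase_atTop hν).eventually_ge_atTop a).and
    (eventually_ge_atTop x)).exists
  obtain ⟨y, hy, hy'⟩ := intermediate_value_Icc hxz
    ((continuousOn_phase hν).mono fun t ht => hx.trans_le ht.1) ⟨ha, hz⟩
  exact ⟨y, hy.1, hy'⟩

/-- If the phases always differ by less than a right angle, then the Wronskian is positive at its
critical points, which are the zeros of `J_ν` and of `Y_μ`, and hence everywhere. -/
theorem wronskianJY_pos_of_cos_pos {ν μ : ℝ} (hν : 0 < ν) (hμ : 0 < μ) (hne : μ ≠ ν)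
    (hcos : ∀ x, 0 < x → 0 < Real.cos (phase μ x - phase ν x)) {x : ℝ} (hx : 0 < x) :
    0 < wronskianJY ν μ x := by
  have hJ0 : ∀ z, 0 < z → besselJ ν z = 0 → 0 < wronskianJY ν μ z := fun z hz h => by
    obtain ⟨c, hc, e⟩ := wronskianJY_of_besselJ_eq_zero hν hμ hz h
    rw [e]
    exact mul_pos hc (hcos z hz)
  have hY0 : ∀ z, 0 < z → besselY μ z = 0 → 0 < wronskianJY ν μ z := fun z hz h => by
    obtain ⟨c, hc, e⟩ := wronskianJY_of_besselY_eq_zero hν hμ hz h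
    rw [e]
    exact mul_pos hc (hcos z hz)
  obtain ⟨a, ha, ha'⟩ := ((eventually_wronskianJY_pos hν hμ).and (Ioo_mem_nhdsGT hx)).exists
  obtain ⟨y, hxy, hy⟩ := exists_phase_eq hμ hx
    (a := ⌈phase μ x / π⌉ * π) ((div_le_iff₀ Real.pi_pos).1 (Int.le_ceil _))
  have hy0 : 0 < y := hx.trans_le hxy
  have hYy : besselY μ y = 0 := by
    rw [(besselJ_eq_cos_and_besselY_eq_sin hμ hy0).2, hy, Real.sin_int_mul_pi, mul_zero]
  obtain ⟨z, hz, hmin⟩ := (isCompact_Icc (a := a) (b := y)).exists_isMinOn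
    ⟨x, ha'.2.le, hxy⟩ ((continuousOn_wronskianJY ν μ).mono fun t ht => ha'.1.trans_le ht.1)
  refine lt_of_lt_of_le ?_ (hmin ⟨ha'.2.le, hxy⟩)
  have hz0 : 0 < z := ha'.1.trans_le hz.1
  rcases hz.1.eq_or_lt with rfl | haz
  · exact ha
  rcases hz.2.eq_or_lt with rfl | hzy
  · exact hY0 _ hy0 hYy
  have hd := (hmin.isLocalMin (Icc_mem_nhds haz hzy)).hasDerivAt_eq_zero
    (hasDerivAt_wronskianJY ν μ hz0)
  have hne2 : (μ ^ 2 - ν ^ 2) / z ≠ 0 := by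
    refine div_ne_zero ?_ hz0.ne'
    rw [sq_sub_sq]
    exact mul_ne_zero (by positivity) (sub_ne_zero.2 hne)
  rcases mul_eq_zero.1 ((mul_eq_zero.1 hd).resolve_left hne2) with h | h
  · exact hJ0 z hz0 h
  · exact hY0 z hz0 h

theorem cos_phase_sub_pos {μ ν : ℝ} (hμ : 0 < μ) (h : μ < ν) (h1 : ν ≤ μ + 1) {x : ℝ}
    (hx : 0 < x) : 0 < Real.cos (phase μ x - phase ν x) := by
  have h2 := phase_lt_phase hμ h hx
  have h3 := phase_sub_phase_add_one_lt hμ hx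
  have h4 : phase (μ + 1) x ≤ phase ν x := by
    rcases h1.eq_or_lt with rfl | h1
    · exact le_rfl
    · exact (phase_lt_phase (hμ.trans h) h1 hx).le
  exact Real.cos_pos_of_mem_Ioo ⟨by linarith [Real.pi_pos], by linarith⟩

theorem exists_phase_sub_eq {μ ν : ℝ} (hμ : 0 < μ) (h : μ + 1 < ν) :
    ∃ x, 0 < x ∧ phase μ x - phase ν x = π / 2 := by
  have hμ1 : 0 < μ + 1 := by linarith
  have hν : 0 < ν := by linarith
  have hδ := phase_lt_phase hμ1 h one_pos
  obtain ⟨b, hb, hb1⟩ := (((tendsto_phase_sub_phase_add_one hμ).eventually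
    (lt_mem_nhds (show π / 2 - (phase (μ + 1) 1 - phase ν 1) < π / 2 by linarith))).and
    (eventually_ge_atTop 1)).exists
  have hb0 : 0 < b := by linarith
  have h1 := (strictMonoOn_phase_sub hμ1 h).monotoneOn (mem_Ioi.2 one_pos) hb0 hb1
  obtain ⟨a, ha, ha'⟩ := (((tendsto_phase_sub_zero hμ hν).eventually
    (gt_mem_nhds Real.pi_div_two_pos)).and (Ioo_mem_nhdsGT hb0)).exists
  obtain ⟨x, hx, hx'⟩ := intermediate_value_Icc ha'.2.le
    (((continuousOn_phase hμ).sub (continuousOn_phase hν)).mono fun t ht => ha'.1.trans_le ht.1)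
    (show π / 2 ∈ Icc (phase μ a - phase ν a) (phase μ b - phase ν b) from
      ⟨ha.le, by linarith⟩)
  exact ⟨x, ha'.1.trans_le hx.1, hx'⟩

/-- If the orders differ by more than `1`, then the difference of the phases exceeds a right angle
from some point on. At the next point after it where `θ_μ` is in `c + π ℤ`, that difference has
grown by less than `π`, because `θ_ν` increases too. -/
theorem exists_cos_phase_sub_nonpos {μ ν : ℝ} (hμ : 0 < μ) (h : μ + 1 < ν) (c : ℝ) :
    ∃ y, 0 < y ∧ (∃ n : ℤ, phase μ y = n * π + c) ∧ Real.cos (phase μ y - phase ν y) ≤ 0 := by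
  have hν : 0 < ν := by linarith
  obtain ⟨x, hx, hD⟩ := exists_phase_sub_eq hμ h
  have hle := (div_le_iff₀ Real.pi_pos).1 (Int.le_ceil ((phase μ x - c) / π))
  have hlt := mul_lt_mul_of_pos_right (Int.ceil_lt_add_one ((phase μ x - c) / π)) Real.pi_pos
  rw [add_mul, div_mul_cancel₀ _ Real.pi_ne_zero, one_mul] at hlt
  obtain ⟨y, hxy, hy⟩ := exists_phase_eq hμ hx (a := ⌈(phase μ x - c) / π⌉ * π + c) (by linarith)
  have hy0 : 0 < y := hx.trans_le hxy
  refine ⟨y, hy0, ⟨_, hy⟩, ?_⟩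
  have h1 := (strictMonoOn_phase_sub hμ (by linarith : μ < ν)).monotoneOn hx hy0 hxy
  have h2 := (strictMonoOn_phase hν).monotoneOn hx hy0 hxy
  exact Real.cos_nonpos_of_pi_div_two_le_of_le (by linarith) (by linarith)

theorem exists_wronskianJY_eq_zero {ν μ : ℝ} (hν : 0 < ν) (hμ : 0 < μ) (h : 1 < |ν - μ|) :
    ∃ x, 0 < x ∧ wronskianJY ν μ x = 0 := by
  have hex : ∃ y, 0 < y ∧ wronskianJY ν μ y ≤ 0 := by
    rcases lt_abs.1 h with h | h
    · obtain ⟨y, hy, ⟨n, hn⟩, hcos⟩ := exists_cos_phase_sub_nonpos hμ (by linarith : μ + 1 < ν) 0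
      have hY : besselY μ y = 0 := by
        rw [(besselJ_eq_cos_and_besselY_eq_sin hμ hy).2, hn, add_zero, Real.sin_int_mul_pi,
          mul_zero]
      obtain ⟨c, hc, e⟩ := wronskianJY_of_besselY_eq_zero hν hμ hy hY
      exact ⟨y, hy, e ▸ mul_nonpos_of_nonneg_of_nonpos hc.le hcos⟩
    · obtain ⟨y, hy, ⟨n, hn⟩, hcos⟩ :=
        exists_cos_phase_sub_nonpos hν (by linarith : ν + 1 < μ) (π / 2)
      have hJ : besselJ ν y = 0 := by
        rw [(besselJ_eq_cos_and_besselY_eq_sin hν hy).1, hn, Real.cos_add_pi_div_two,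
          Real.sin_int_mul_pi, neg_zero, mul_zero]
      obtain ⟨c, hc, e⟩ := wronskianJY_of_besselJ_eq_zero hν hμ hy hJ
      rw [← Real.cos_neg, neg_sub] at hcos
      exact ⟨y, hy, e ▸ mul_nonpos_of_nonneg_of_nonpos hc.le hcos⟩
  obtain ⟨y, hy, hy'⟩ := hex
  obtain ⟨a, ha, ha'⟩ := ((eventually_wronskianJY_pos hν hμ).and (Ioo_mem_nhdsGT hy)).exists
  obtain ⟨x, hx, hx'⟩ := intermediate_value_Icc' ha'.2.le
    ((continuousOn_wronskianJY ν μ).mono fun t ht => ha'.1.trans_le ht.1) ⟨hy', ha.le⟩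
  exact ⟨x, ha'.1.trans_le hx.1, hx'⟩

end Bessel

theorem mainTheorem1 (L l : ℝ) (hL : -1 / 2 < L) (hl : -1 / 2 < l) (hne : L ≠ l) :
    (∀ x : ℝ, 0 < x → riccatiWronskian L l x ≠ 0) ↔ (0 < |L - l| ∧ |L - l| ≤ 1) := by
  have hν : 0 < L + 1 / 2 := by linarith
  have hμ : 0 < l + 1 / 2 := by linarith
  have hsub : L + 1 / 2 - (l + 1 / 2) = L - l := by ring
  constructor
  · intro h
    refine ⟨abs_pos.2 (sub_ne_zero.2 hne), ?_⟩
    by_contra! hlt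
    rw [← hsub] at hlt
    obtain ⟨x, hx, hx'⟩ := Bessel.exists_wronskianJY_eq_zero hν hμ hlt
    exact h x hx (by rw [Bessel.riccatiWronskian_eq L l hx, hx', mul_zero])
  · rintro ⟨-, h⟩ x hx
    rw [Bessel.riccatiWronskian_eq L l hx]
    have hne' : l + 1 / 2 ≠ L + 1 / 2 := fun e => hne (by linarith)
    refine (mul_pos Real.pi_div_two_pos
      (Bessel.wronskianJY_pos_of_cos_pos hν hμ hne' (fun y hy => ?_) hx)).ne'
    rw [abs_le] at h
    rcases lt_or_gt_of_ne hne' with hlt | hlt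
    · exact Bessel.cos_phase_sub_pos hμ hlt (by linarith [h.2]) hy
    · rw [← Real.cos_neg, neg_sub]
      exact Bessel.cos_phase_sub_pos hν hlt (by linarith [h.1]) hy
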